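/- Let $\rho=\rho^{AB}$ be a two-qubit X state, i.e. a density matrix on $\mathbb C^2\otimes\mathbb C^2$ whose only nonzero entries, in the product basis $|00\rangle,|01\rangle,|10\rangle,|11\rangle$, are the diagonal entries $a,b,c,d$ and the skew-diagonal entries $u=\rho_{00,11}$, $v=\rho_{01,10}\in\mathbb C$ and their conjugates. For a POVM $M=\{M_i\}$ on $A$ with finitely many elements put $p_i=\mathrm{Tr}[(M_i\otimes 1)\rho]$, $\rho^{B|M_i}=\mathrm{Tr}_A[(M_i\otimes 1)\rho]/p_i$ and $\overline S(M)=\sum_i p_iS(\rho^{B|M_i})$, where $S$ is the von Neumann entropy in base $2$ and outcomes with $p_i=0$ contribute $0$. Call $M$ optimal if $\overline S(M)\le\overline S(N)$ for every POVM $N$ on $A$ with finitely many elements (of any rank). An $n$-element rank-one POVM is one with $n$ elements, all of rank one, no two of which are proportional. Put $\ell_1=\frac{|u|+|v|}{\sqrt{(a+b)(c+d)}}$, $\ell_3=\frac{|ad-bc|}{(a+b)(c+d)}$, $z_0=\frac{ac-bd}{(a+b)(c+d)}$; if $(a+b)(c+d)=0$, these are taken to be $0$. The steering ellipse $\mathbf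 E$ of $\rho$ is $x^2/\ell_1^2+(z-z_0)^2/\ell_3^2=1$ (degenerate if $\ell_1\ell_3=0$). (1) Suppose that $\mathbf E$ is neither a single point ($\ell_1=\ell_3=0$, i.e. $\rho$ is a product state) nor a circle centred at the origin ($\ell_1=\ell_3$, $z_0=0$). Consider the rank-one POVMs on $A$ whose elements all have their Bloch vectors in one plane containing the $z$ axis; if $uv\neq0$, consider all rank-one POVMs on $A$, without this restriction. Then no such four-element rank-one POVM is optimal. Moreover, every such rank-one POVM, with any number of elements, that is optimal is either a two-outcome von Neumann measurement (two rank-one projectors) or has exactly three elements. (2) For every X state, without exception, there is an optimal POVM that is either a two-outcome von Neumann measurement or a three-element rank-one POVM. -/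

import Mathlib

open scoped Matrix Kronecker ComplexOrder

noncomputable section

namespace XStateDiscord

/-- Operators on one qubit. -/
abbrev Qubit : Type := Matrix (Fin 2) (Fin 2) ℂ

/-- Operators on two qubits; in an index `(i, j)`, `i` belongs to `A` and `j` to `B`. -/
abbrev TwoQubit : Type := Matrix (Fin 2 × Fin 2) (Fin 2 × Fin 2) ℂ

/-- A two-qubit X state: a density matrix (positive semidefinite with unit trace) whose nonzero
entries lie on the diagonal or on the skew diagonal, in the product basis
`(0,0), (0,1), (1,0), (1,1)`. -/
structure IsXState (ρ : TwoQubit) : Prop where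
  posSemidef : ρ.PosSemidef
  trace_eq_one : ρ.trace = 1
  eq_zero : ∀ i j k l : Fin 2,
    ¬ (i = k ∧ j = l) → ¬ (i ≠ k ∧ j ≠ l) → ρ (i, j) (k, l) = 0

/-- The partial trace over `A`. -/
def partialTraceA (ρ : TwoQubit) : Qubit :=
  Matrix.of fun j l => ∑ i : Fin 2, ρ (i, j) (i, l)

open Classical in
/-- The von Neumann entropy `-Tr(σ log₂ σ)` of a Hermitian matrix, computed from its
eigenvalues. -/
def vonNeumannEntropy (σ : Qubit) : ℝ :=
  if h : σ.IsHermitian then (∑ i, Real.negMulLog (h.eigenvalues i)) / Real.log 2 else 0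

/-- A POVM on qubit `A` with `k` elements. -/
structure POVM (k : ℕ) where
  /-- the elements of the POVM -/
  elem : Fin k → Qubit
  posSemidef : ∀ i, (elem i).PosSemidef
  sum_eq_one : ∑ i, elem i = 1

/-- The unnormalized state `Tr_A[(E ⊗ 1) ρ]` of `B` after the outcome `E` on `A`. -/
def steered (ρ : TwoQubit) (E : Qubit) : Qubit :=
  partialTraceA ((E ⊗ₖ (1 : Qubit)) * ρ)

/-- The probability `Tr[(E ⊗ 1) ρ]` of the outcome `E`. -/
def outcomeProb (ρ : TwoQubit) (E : Qubit) : ℝ :=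
  (((E ⊗ₖ (1 : Qubit)) * ρ).trace).re

/-- The normalized state of `B` after the outcome `E` on `A`. -/
def conditionalState (ρ : TwoQubit) (E : Qubit) : Qubit :=
  ((outcomeProb ρ E : ℂ)⁻¹) • steered ρ E

/-- The average conditional entropy `∑ pᵢ S(ρ^{B|Mᵢ})`; an outcome of probability zero contributes
zero. -/
def averageEntropy (ρ : TwoQubit) {k : ℕ} (M : POVM k) : ℝ :=
  ∑ i, outcomeProb ρ (M.elem i) * vonNeumannEntropy (conditionalState ρ (M.elem i))

/-- `M` minimizes the average conditional entropy among all POVMs on `A`, with any finite number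
of elements of any rank. -/
def IsOptimal (ρ : TwoQubit) {k : ℕ} (M : POVM k) : Prop :=
  ∀ (m : ℕ) (N : POVM m), averageEntropy ρ M ≤ averageEntropy ρ N

/-- All elements have rank one, and no two of them are proportional (so that the number of
elements is not raised artificially by splitting an element). -/
def POVM.IsRankOne {k : ℕ} (M : POVM k) : Prop :=
  (∀ i, (M.elem i).rank = 1) ∧ ∀ i j, i ≠ j → ∀ c : ℝ, M.elem i ≠ (c : ℂ) • M.elem j

/-- A von Neumann measurement: two rank-one projectors with sum `1`. -/
def POVM.IsVonNeumann {k : ℕ} (M : POVM k) : Prop :=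
  k = 2 ∧ ∀ i, (M.elem i).rank = 1 ∧ M.elem i * M.elem i = M.elem i

/-- The Bloch vectors of all elements lie in one plane containing the `z` axis. The `x` and `y`
components of the Bloch vector of an element are given by its off-diagonal entry; the plane is
the `x`-`z` plane for `ω = 1`. -/
def POVM.InVerticalPlane {k : ℕ} (M : POVM k) : Prop :=
  ∃ ω : ℂ, ‖ω‖ = 1 ∧ ∀ i, ∃ t : ℝ, M.elem i 0 1 = (t : ℂ) * ω

/-- `(a + b)(c + d)`, the product of the eigenvalues of `ρ^A`, where `a, b, c, d` are the
diagonal entries of `ρ`. -/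
def margDet (ρ : TwoQubit) : ℝ :=
  ((ρ (0, 0) (0, 0)).re + (ρ (0, 1) (0, 1)).re) * ((ρ (1, 0) (1, 0)).re + (ρ (1, 1) (1, 1)).re)

/-- The horizontal semiaxis `ℓ₁ = (|u| + |v|) / √((a + b)(c + d))` of the steering ellipse. -/
def semiaxis₁ (ρ : TwoQubit) : ℝ :=
  (‖ρ (0, 0) (1, 1)‖ + ‖ρ (0, 1) (1, 0)‖) / √(margDet ρ)

/-- The vertical semiaxis `ℓ₃ = |ad - bc| / ((a + b)(c + d))` of the steering ellipse. -/
def semiaxis₃ (ρ : TwoQubit) : ℝ :=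
  |(ρ (0, 0) (0, 0)).re * (ρ (1, 1) (1, 1)).re - (ρ (0, 1) (0, 1)).re * (ρ (1, 0) (1, 0)).re|
    / margDet ρ

/-- The height `z₀ = (ac - bd) / ((a + b)(c + d))` of the centre of the steering ellipse. -/
def centre (ρ : TwoQubit) : ℝ :=
  ((ρ (0, 0) (0, 0)).re * (ρ (1, 0) (1, 0)).re - (ρ (0, 1) (0, 1)).re * (ρ (1, 1) (1, 1)).re)
    / margDet ρ

/-- The steering ellipse is a single point (the state is a product state; this covers
`(a + b)(c + d) = 0`, where all three quotients are zero) or a circle centred at the origin.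
Then the entropy is constant on the ellipse, and all measurements in its plane that consist of
rank-one elements give the same average entropy. -/
def HasConstantEntropyEllipse (ρ : TwoQubit) : Prop :=
  (semiaxis₁ ρ = 0 ∧ semiaxis₃ ρ = 0) ∨ (semiaxis₁ ρ = semiaxis₃ ρ ∧ centre ρ = 0)

/-- The elements of `M` lie in one plane through the `z` axis, or both skew-diagonal entries `u`
and `v` of `ρ` are nonzero. If `u v = 0`, the steering ellipsoid is a surface of revolution about
the `z` axis, and one of its meridian planes has to be chosen; if `u v ≠ 0`, nothing is
required of `M`. -/
def IsAdmissible (ρ : TwoQubit) {k : ℕ} (M : POVM k) : Prop :=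
  (ρ (0, 0) (1, 1) ≠ 0 ∧ ρ (0, 1) (1, 0) ≠ 0) ∨ M.InVerticalPlane

end XStateDiscord

end

/-! Conjugation by the square root of the marginal of `A` turns a POVM into a decomposition of that
marginal: outcome i gets a probability p_i and a height z_i in [-1, 1], and the mean height is
always `marginalHeight`. At a given height the conditional Bloch vector on `B` has squared length at
most `conic ρ z`, its value on the steering ellipse (`conditionalBlochSq_le`). Entropy decreases
with length, so the average entropy (in nats) is at least the mean of g(z_i), where g(z) =
`blochEntropy (conic ρ z)`. The minimum is the convex envelope of g at the marginal height.

Existence: the envelope is attained on at most two heights (`exists_affine_le_and_eq`). A height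
strictly between -1 and 1 belongs to two mirror points of the ellipse. The horizontal components
have to cancel, and splitting one height between its mirror points achieves this with two or three
rank-one elements (`exists_attaining_of_pair`).

Exclusion: in an optimal POVM every outcome lies on the ellipse, at a height where a supporting line
touches g (`outcome_of_averageEntropy_le`). If uv ≠ 0, this already forces the elements into one
vertical plane. The line touches g in at most one point and one endpoint
(`touchesAtMost_blochEntropy`): g is strictly concave, or strictly convex, or its second derivative
vanishes at most once, the last because `curvatureRatio` is strictly increasing. Within the plane a
height carries at most two nonproportional elements and an endpoint only one, so there are at most
three. -/

namespace XStateDiscord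

open Real Set

/-! ### Bounds for the inverse hyperbolic tangent; concavity of the entropy in the squared Bloch
length. -/

/-- The inverse hyperbolic tangent on `(-1, 1)`, as a difference of logarithms. -/
noncomputable def logRatio (r : ℝ) : ℝ := (log (1 + r) - log (1 - r)) / 2

/-- The entropy (in nats) of a qubit state whose Bloch vector has squared length `q`. -/
noncomputable def blochEntropy (q : ℝ) : ℝ := binEntropy ((1 + √q) / 2)

theorem sqrt_lt_one {q : ℝ} : √q < 1 ↔ q < 1 := by
  rw [sqrt_lt' one_pos, one_pow]

theorem hasDerivAt_logRatio {r : ℝ} (h0 : -1 < r) (h1 : r < 1) :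
    HasDerivAt logRatio (1 / (1 - r ^ 2)) r := by
  have h2 : (1 + r) ≠ 0 := by linarith
  have h3 : (1 - r) ≠ 0 := by linarith
  have h4 : 1 - r ^ 2 ≠ 0 := by nlinarith
  have := (((hasDerivAt_id r).const_add 1).log h2).sub (((hasDerivAt_id r).const_sub 1).log h3)
  refine (this.div_const 2).congr_deriv ?_
  simp only [id]
  field_simp
  ring

theorem pos_of_hasDerivAt_pos {f f' : ℝ → ℝ} (hf : ∀ r, 0 ≤ r → r < 1 → HasDerivAt f (f' r) r)
    (h0 : f 0 = 0) (hpos : ∀ r, 0 < r → r < 1 → 0 < f' r) {r : ℝ} (hr0 : 0 < r) (hr1 : r < 1) :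
    0 < f r := by
  have hm : StrictMonoOn f (Ico 0 1) := by
    refine strictMonoOn_of_deriv_pos (convex_Ico 0 1)
      (fun x hx => (hf x hx.1 hx.2).continuousAt.continuousWithinAt) fun x hx => ?_
    rw [interior_Ico] at hx
    rw [(hf x hx.1.le hx.2).deriv]
    exact hpos x hx.1 hx.2
  rw [← h0]
  exact hm ⟨le_rfl, one_pos⟩ ⟨hr0.le, hr1⟩ hr0

theorem logRatio_zero : logRatio 0 = 0 := by simp [logRatio]

theorem lt_logRatio {r : ℝ} (h0 : 0 < r) (h1 : r < 1) : r < logRatio r := by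
  have := pos_of_hasDerivAt_pos (f := fun x => logRatio x - x)
    (fun x hx0 hx1 => (hasDerivAt_logRatio (by linarith) hx1).sub (hasDerivAt_id x))
    (by simp [logRatio_zero]) (fun x hx0 hx1 => by
      rw [sub_pos, lt_div_iff₀ (by nlinarith)]; nlinarith) h0 h1
  simpa using this

theorem logRatio_lt {r : ℝ} (h0 : 0 < r) (h1 : r < 1) : logRatio r < r / (1 - r ^ 2) := by
  have := pos_of_hasDerivAt_pos (f := fun x => x / (1 - x ^ 2) - logRatio x)
    (f' := fun x => (1 * (1 - x ^ 2) - x * (-(2 * x))) / (1 - x ^ 2) ^ 2 - 1 / (1 - x ^ 2))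
    (fun x hx0 hx1 => ((hasDerivAt_id x).div
      (((hasDerivAt_pow 2 x).const_sub 1).congr_deriv (by norm_num))
      (by nlinarith)).sub (hasDerivAt_logRatio (by linarith) hx1))
    (by simp [logRatio_zero]) (fun x hx0 hx1 => by
      have : 0 < 1 - x ^ 2 := by nlinarith
      rw [sub_pos, div_lt_div_iff₀ this (by positivity)]
      nlinarith [mul_pos this (mul_pos hx0 hx0)]) h0 h1
  simpa using this

/-- This bound is exactly the positivity of the derivative of `curvatureRatio`. -/
theorem three_mul_div_lt_logRatio {r : ℝ} (h0 : 0 < r) (h1 : r < 1) :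
    3 * r / (3 - r ^ 2) < logRatio r := by
  have := pos_of_hasDerivAt_pos (f := fun x => logRatio x - 3 * x / (3 - x ^ 2))
    (f' := fun x => 1 / (1 - x ^ 2) - (3 * (3 - x ^ 2) - 3 * x * (-(2 * x))) / (3 - x ^ 2) ^ 2)
    (fun x hx0 hx1 => (hasDerivAt_logRatio (by linarith) hx1).sub
      ((((hasDerivAt_id x).const_mul 3).congr_deriv (by simp)).div
      (((hasDerivAt_pow 2 x).const_sub 3).congr_deriv (by norm_num))
      (by nlinarith)))
    (by simp [logRatio_zero]) (fun x hx0 hx1 => by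
      have h3 : 0 < 1 - x ^ 2 := by nlinarith
      have h4 : 0 < 3 - x ^ 2 := by nlinarith
      rw [sub_pos, div_lt_div_iff₀ (by positivity) h3]
      -- After cross-multiplication the two sides differ by exactly 4x⁴.
      nlinarith [pow_pos hx0 4]) h0 h1
  simpa using this

/-- The quotient of two power series with which the curvature of the entropy along a conic
changes sign. -/
noncomputable def curvatureRatio (r : ℝ) : ℝ := (r - (1 - r ^ 2) * logRatio r) / r ^ 3

theorem curvatureRatio_pos {r : ℝ} (h0 : 0 < r) (h1 : r < 1) : 0 < curvatureRatio r := by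
  have h2 : 0 < 1 - r ^ 2 := by nlinarith
  have := logRatio_lt h0 h1
  rw [lt_div_iff₀ h2] at this
  exact div_pos (by linarith) (by positivity)

theorem curvatureRatio_lt_one {r : ℝ} (h0 : 0 < r) (h1 : r < 1) : curvatureRatio r < 1 := by
  have h2 : 0 < 1 - r ^ 2 := by nlinarith
  rw [curvatureRatio, div_lt_one (by positivity)]
  nlinarith [lt_logRatio h0 h1]

theorem strictMonoOn_curvatureRatio : StrictMonoOn curvatureRatio (Ioo 0 1) := by
  have hd : ∀ r ∈ Ioo (0 : ℝ) 1, HasDerivAt curvatureRatio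
      (((3 - r ^ 2) * logRatio r - 3 * r) / r ^ 4) r := fun r hr => by
    have hr0 : r ≠ 0 := hr.1.ne'
    have h2 : 1 - r ^ 2 ≠ 0 := by nlinarith [hr.1, hr.2]
    refine (((hasDerivAt_id r).sub (((hasDerivAt_pow 2 r).const_sub 1).mul
      (hasDerivAt_logRatio (by linarith [hr.1]) hr.2))).div (hasDerivAt_pow 3 r)
      (pow_ne_zero 3 hr0)).congr_deriv ?_
    simp only [Pi.sub_apply, Pi.mul_apply, id]
    field_simp
    push_cast
    ring
  refine strictMonoOn_of_deriv_pos (convex_Ioo 0 1)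
    (fun x hx => (hd x hx).continuousAt.continuousWithinAt) fun x hx => ?_
  rw [interior_Ioo] at hx
  rw [(hd x hx).deriv]
  have h2 : 0 < 3 - x ^ 2 := by nlinarith [hx.1, hx.2]
  have := three_mul_div_lt_logRatio hx.1 hx.2
  rw [div_lt_iff₀ h2] at this
  exact div_pos (by linarith) (pow_pos hx.1 4)

theorem continuous_blochEntropy : Continuous blochEntropy := by
  unfold blochEntropy; fun_prop

theorem strictAntiOn_blochEntropy : StrictAntiOn blochEntropy (Icc 0 1) := by
  intro x hx y hy hxy
  have h1 : √x < √y := sqrt_lt_sqrt hx.1 hxy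
  have h2 : √y ≤ 1 := sqrt_le_one.2 hy.2
  have h3 := sqrt_nonneg x
  exact binEntropy_strictAntiOn ⟨by norm_num; linarith, by linarith⟩
    ⟨by norm_num; linarith, by linarith⟩ (by linarith)

theorem hasDerivAt_blochEntropy {q : ℝ} (h0 : 0 < q) (h1 : q < 1) :
    HasDerivAt blochEntropy (-(logRatio √q / (2 * √q))) q := by
  have hr0 : 0 < √q := sqrt_pos.2 h0
  have hr1 : √q < 1 := sqrt_lt_one.2 h1
  have hd := ((hasDerivAt_sqrt h0.ne').const_add 1).div_const 2
  have hb := hasDerivAt_binEntropy (p := (1 + √q) / 2) (by positivity) (by linarith)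
  refine (HasDerivAt.comp q hb hd).congr_deriv ?_
  have e1 : (1 : ℝ) - (1 + √q) / 2 = (1 - √q) / 2 := by ring
  rw [e1, log_div (by linarith) (by norm_num), log_div (by linarith) (by norm_num), logRatio]
  field_simp
  ring

theorem strictMonoOn_logRatio_div : StrictMonoOn (fun r => logRatio r / r) (Ioo 0 1) := by
  have hd : ∀ r ∈ Ioo (0 : ℝ) 1, HasDerivAt (fun r => logRatio r / r)
      ((r / (1 - r ^ 2) - logRatio r) / r ^ 2) r := fun r hr => by
    refine ((hasDerivAt_logRatio (by linarith [hr.1]) hr.2).div (hasDerivAt_id r)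
      hr.1.ne').congr_deriv ?_
    simp only [id]
    ring
  refine strictMonoOn_of_deriv_pos (convex_Ioo 0 1)
    (fun x hx => (hd x hx).continuousAt.continuousWithinAt) fun x hx => ?_
  rw [interior_Ioo] at hx
  rw [(hd x hx).deriv]
  exact div_pos (sub_pos.2 (logRatio_lt hx.1 hx.2)) (pow_pos hx.1 2)

/-- With r = √q the derivative is -artanh(r) / (2r), and artanh(r) / r is strictly increasing. -/
theorem strictConcaveOn_blochEntropy : StrictConcaveOn ℝ (Icc 0 1) blochEntropy := by
  refine StrictAntiOn.strictConcaveOn_of_deriv (convex_Icc 0 1)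
    continuous_blochEntropy.continuousOn ?_
  rw [interior_Icc]
  intro x hx y hy hxy
  rw [(hasDerivAt_blochEntropy hx.1 hx.2).deriv, (hasDerivAt_blochEntropy hy.1 hy.2).deriv]
  have := strictMonoOn_logRatio_div ⟨sqrt_pos.2 hx.1, sqrt_lt_one.2 hx.2⟩
    ⟨sqrt_pos.2 hy.1, sqrt_lt_one.2 hy.2⟩ (sqrt_lt_sqrt hx.1.le hxy)
  simp only at this
  rw [mul_comm 2, ← div_div, mul_comm 2, ← div_div]
  linarith

/-- The entropy along a conic that opens upwards is strictly concave. -/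
theorem strictConcaveOn_blochEntropy_comp {A B C : ℝ} (hA : 0 ≤ A) (hAB : A ≠ 0 ∨ B ≠ 0)
    (hq : ∀ z ∈ Icc (-1 : ℝ) 1, A * z ^ 2 + 2 * B * z + C ∈ Icc (0 : ℝ) 1) :
    StrictConcaveOn ℝ (Icc (-1) 1) (fun z => blochEntropy (A * z ^ 2 + 2 * B * z + C)) := by
  refine ⟨convex_Icc _ _, fun x hx y hy hxy s t hs ht hst => ?_⟩
  have hm : s • x + t • y ∈ Icc (-1 : ℝ) 1 := convex_Icc _ _ hx hy hs.le ht.le hst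
  have hqx := hq x hx
  have hqy := hq y hy
  have hqm := hq _ hm
  simp only [smul_eq_mul] at hqm ⊢
  have hid : s * (A * x ^ 2 + 2 * B * x + C) + t * (A * y ^ 2 + 2 * B * y + C) =
      A * (s * x + t * y) ^ 2 + 2 * B * (s * x + t * y) + C + A * (s * t * (x - y) ^ 2) := by
    obtain rfl : t = 1 - s := by linarith
    ring
  have hst' : 0 < s * t * (x - y) ^ 2 := by
    have := sub_ne_zero.2 hxy; positivity
  have hmid : s * (A * x ^ 2 + 2 * B * x + C) + t * (A * y ^ 2 + 2 * B * y + C) ∈ Icc (0 : ℝ) 1 :=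
    convex_Icc _ _ hqx hqy hs.le ht.le hst
  -- If the conic takes equal values at x and y, strictness comes from the conic itself: A > 0,
  -- since a nonconstant affine function is injective. Otherwise it comes from the strict concavity
  -- of `blochEntropy`.
  by_cases h : A * x ^ 2 + 2 * B * x + C = A * y ^ 2 + 2 * B * y + C
  · have hApos : 0 < A := by
      rcases hA.lt_or_eq with h' | rfl
      · exact h'
      · have : B ≠ 0 := by simpa using hAB
        exact absurd (by simpa [this] using h) hxy
    have := strictAntiOn_blochEntropy hqm hmid (by nlinarith)
    rw [h, ← add_mul, hst, one_mul] at this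
    rw [h, ← add_mul, hst, one_mul]
    exact this
  · have h1 := strictConcaveOn_blochEntropy.2 hqx hqy h hs ht hst
    have h2 := strictAntiOn_blochEntropy.antitoneOn hqm hmid (by nlinarith [mul_nonneg hA hst'.le])
    simp only [smul_eq_mul] at h1
    linarith

/-! ### Entropy along a conic that opens downwards. -/

section Downward

variable {κ M t : ℝ}

/-- The derivative of the entropy along a conic that opens downwards. -/
noncomputable def conicDeriv (κ M t : ℝ) : ℝ :=
  κ * t * (logRatio √(M - κ * t ^ 2) / √(M - κ * t ^ 2))

theorem hasDerivAt_sub_mul_sq : HasDerivAt (fun t => M - κ * t ^ 2) (-(2 * κ * t)) t :=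
  (((hasDerivAt_pow 2 t).const_mul κ).const_sub M).congr_deriv (by norm_num; ring)

theorem hasDerivAt_blochEntropy_conic (h0 : 0 < M - κ * t ^ 2) (h1 : M - κ * t ^ 2 < 1) :
    HasDerivAt (fun t => blochEntropy (M - κ * t ^ 2)) (conicDeriv κ M t) t := by
  refine (HasDerivAt.comp t (hasDerivAt_blochEntropy h0 h1) hasDerivAt_sub_mul_sq).congr_deriv ?_
  have : √(M - κ * t ^ 2) ≠ 0 := (sqrt_pos.2 h0).ne'
  rw [conicDeriv]
  field_simp

theorem hasDerivAt_conicDeriv (h0 : 0 < M - κ * t ^ 2) (h1 : M - κ * t ^ 2 < 1) :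
    HasDerivAt (conicDeriv κ M)
      (κ / (1 - (M - κ * t ^ 2)) * (1 - M * curvatureRatio √(M - κ * t ^ 2))) t := by
  have hr0 : 0 < √(M - κ * t ^ 2) := sqrt_pos.2 h0
  have hr1 : √(M - κ * t ^ 2) < 1 := sqrt_lt_one.2 h1
  have hs := HasDerivAt.sqrt (hasDerivAt_sub_mul_sq (κ := κ) (M := M) (t := t)) h0.ne'
  have hL := HasDerivAt.comp t (hasDerivAt_logRatio (by linarith) hr1) hs
  refine (((hasDerivAt_id t).const_mul κ).mul (hL.div hs hr0.ne')).congr_deriv ?_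
  have hsq : √(M - κ * t ^ 2) ^ 2 = M - κ * t ^ 2 := sq_sqrt h0.le
  simp only [Function.comp_apply, Pi.div_apply, id]
  rw [curvatureRatio]
  set r := √(M - κ * t ^ 2) with hr
  clear_value r
  obtain rfl : M = r ^ 2 + κ * t ^ 2 := by linarith
  have h3 : 1 - r ^ 2 ≠ 0 := by nlinarith
  have h4 : 1 - (r ^ 2 + κ * t ^ 2 - κ * t ^ 2) ≠ 0 := by ring_nf; ring_nf at h3; exact h3
  field_simp
  ring

theorem conicDeriv_pos (hκ : 0 < κ) (ht : 0 < t) (h0 : 0 < M - κ * t ^ 2)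
    (h1 : M - κ * t ^ 2 < 1) : 0 < conicDeriv κ M t := by
  have hr0 : 0 < √(M - κ * t ^ 2) := sqrt_pos.2 h0
  have := lt_logRatio hr0 (sqrt_lt_one.2 h1)
  have : 0 < logRatio √(M - κ * t ^ 2) := by linarith
  unfold conicDeriv
  positivity

/-- Allows convexity to be checked on one side of the vertex only. At the vertex the conic may reach
1, where the derivative formulas are not available. -/
theorem strictConvexOn_comp_abs {k : ℝ → ℝ} {R : ℝ} (hk : StrictConvexOn ℝ (Icc 0 R) k)
    (hm : StrictMonoOn k (Icc 0 R)) : StrictConvexOn ℝ (Icc (-R) R) (fun t => k |t|) := by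
  refine ⟨convex_Icc _ _, fun x hx y hy hxy s t hs ht hst => ?_⟩
  have hx' : |x| ∈ Icc 0 R := ⟨abs_nonneg x, abs_le.2 hx⟩
  have hy' : |y| ∈ Icc 0 R := ⟨abs_nonneg y, abs_le.2 hy⟩
  have hz : s • x + t • y ∈ Icc (-R) R := convex_Icc _ _ hx hy hs.le ht.le hst
  have hz' : |s • x + t • y| ∈ Icc 0 R := ⟨abs_nonneg _, abs_le.2 hz⟩
  have hw : s • |x| + t • |y| ∈ Icc 0 R := convex_Icc _ _ hx' hy' hs.le ht.le hst
  have hle : |s • x + t • y| ≤ s • |x| + t • |y| := by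
    refine (abs_add_le _ _).trans_eq ?_
    simp [abs_mul, abs_of_pos hs, abs_of_pos ht]
  by_cases h : |x| = |y|
  · have hyx : y = -x := by
      rcases abs_eq_abs.1 h with h' | h'
      · exact absurd h' hxy
      · linarith
    have hx0 : x ≠ 0 := by rintro rfl; exact hxy (by simp [hyx])
    have hlt : |s • x + t • y| < |y| := by
      rw [← h, hyx, smul_eq_mul, smul_eq_mul,
        show s * x + t * -x = (s - t) * x by ring, abs_mul]
      have : |s - t| < 1 := abs_lt.2 ⟨by linarith, by linarith⟩
      nlinarith [abs_pos.2 hx0]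
    have := hm hz' hy' hlt
    simp only [h, ← add_smul, hst, one_smul]
    exact this
  · exact (hm.monotoneOn hz' hw hle).trans_lt (hk.2 hx' hy' h hs ht hst)

/-- Since `curvatureRatio` lies between 0 and 1, the factor 1 - M * `curvatureRatio` of the second
derivative is positive when M ≤ 1. -/
theorem strictConvexOn_blochEntropy_conic (hκ : 0 < κ) (hM : M ≤ 1) {R : ℝ}
    (hR : 0 ≤ M - κ * R ^ 2) :
    StrictConvexOn ℝ (Icc (-R) R) (fun t => blochEntropy (M - κ * t ^ 2)) := by
  have hc : Continuous (fun t => blochEntropy (M - κ * t ^ 2)) :=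
    continuous_blochEntropy.comp (by fun_prop)
  have hb : ∀ t ∈ Ioo 0 R, 0 < M - κ * t ^ 2 ∧ M - κ * t ^ 2 < 1 := fun t ht => by
    have h1 : t ^ 2 < R ^ 2 := by nlinarith [ht.1, ht.2]
    have h2 : 0 < t ^ 2 := pow_pos ht.1 2
    constructor <;> nlinarith
  have hm : StrictMonoOn (fun t => blochEntropy (M - κ * t ^ 2)) (Icc 0 R) := by
    refine strictMonoOn_of_deriv_pos (convex_Icc 0 R) hc.continuousOn fun t ht => ?_
    rw [interior_Icc] at ht
    obtain ⟨h0, h1⟩ := hb t ht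
    rw [(hasDerivAt_blochEntropy_conic h0 h1).deriv]
    exact conicDeriv_pos hκ ht.1 h0 h1
  have hd : StrictMonoOn (conicDeriv κ M) (Ioo 0 R) := by
    refine strictMonoOn_of_deriv_pos (convex_Ioo 0 R) (fun t ht =>
      (hasDerivAt_conicDeriv (hb t ht).1 (hb t ht).2).continuousAt.continuousWithinAt)
      fun t ht => ?_
    rw [interior_Ioo] at ht
    obtain ⟨h0, h1⟩ := hb t ht
    rw [(hasDerivAt_conicDeriv h0 h1).deriv]
    have hr0 : 0 < √(M - κ * t ^ 2) := sqrt_pos.2 h0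
    have hr1 : √(M - κ * t ^ 2) < 1 := sqrt_lt_one.2 h1
    have h3 := curvatureRatio_lt_one hr0 hr1
    have h4 := curvatureRatio_pos hr0 hr1
    exact mul_pos (div_pos hκ (by linarith)) (by nlinarith)
  have hk : StrictConvexOn ℝ (Icc 0 R) (fun t => blochEntropy (M - κ * t ^ 2)) := by
    refine StrictMonoOn.strictConvexOn_of_deriv (convex_Icc 0 R) hc.continuousOn ?_
    rw [interior_Icc]
    intro x hx y hy hxy
    rw [(hasDerivAt_blochEntropy_conic (hb x hx).1 (hb x hx).2).deriv,
      (hasDerivAt_blochEntropy_conic (hb y hy).1 (hb y hy).2).deriv]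
    exact hd hx hy hxy
  have := strictConvexOn_comp_abs hk hm
  simpa only [sq_abs] using this

/-- Away from the vertex, the second derivative of the entropy along a conic that opens downwards
vanishes at most once. -/
theorem conicDeriv_deriv_injective (hκ : 0 < κ) {s t : ℝ} (hst : s ^ 2 = t ^ 2 → s = t)
    (hs0 : 0 < M - κ * s ^ 2) (hs1 : M - κ * s ^ 2 < 1)
    (ht0 : 0 < M - κ * t ^ 2) (ht1 : M - κ * t ^ 2 < 1)
    (hs : κ / (1 - (M - κ * s ^ 2)) * (1 - M * curvatureRatio √(M - κ * s ^ 2)) = 0)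
    (ht : κ / (1 - (M - κ * t ^ 2)) * (1 - M * curvatureRatio √(M - κ * t ^ 2)) = 0) :
    s = t := by
  have hs' := (mul_eq_zero.1 hs).resolve_left (div_pos hκ (by linarith)).ne'
  have ht' := (mul_eq_zero.1 ht).resolve_left (div_pos hκ (by linarith)).ne'
  have hM : M ≠ 0 := by rintro rfl; norm_num at hs'
  have h := strictMonoOn_curvatureRatio.injOn
    ⟨sqrt_pos.2 hs0, sqrt_lt_one.2 hs1⟩ ⟨sqrt_pos.2 ht0, sqrt_lt_one.2 ht1⟩
    (mul_left_cancel₀ hM (by linarith))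
  rw [sqrt_inj hs0.le ht0.le] at h
  exact hst (mul_left_cancel₀ hκ.ne' (by linarith))

end Downward


/-! ### Supporting lines and their points of contact. -/

/-- An affine function below a continuous function on `[-1, 1]` that touches its convex envelope
at `ζ`; the value of the envelope is attained at a convex combination of two points. -/
theorem exists_affine_le_and_eq {g : ℝ → ℝ} (hg : Continuous g) {ζ : ℝ} (hζ : ζ ∈ Ioo (-1 : ℝ) 1) :
    ∃ m s z₁ z₂ c : ℝ, z₁ ∈ Icc (-1 : ℝ) 1 ∧ z₂ ∈ Icc (-1 : ℝ) 1 ∧ c ∈ Icc (0 : ℝ) 1 ∧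
      c * z₁ + (1 - c) * z₂ = ζ ∧ c * g z₁ + (1 - c) * g z₂ = m + s * ζ ∧
      ∀ w ∈ Icc (-1 : ℝ) 1, m + s * w ≤ g w := by
  let K : Set (ℝ × ℝ × ℝ) := (Icc (-1) 1 ×ˢ Icc (-1) 1 ×ˢ Icc 0 1) ∩
    {x | x.2.2 * x.1 + (1 - x.2.2) * x.2.1 = ζ}
  have hK : IsCompact K := (isCompact_Icc.prod (isCompact_Icc.prod isCompact_Icc)).inter_right
    (isClosed_eq (by fun_prop) continuous_const)
  have hne : K.Nonempty :=
    ⟨(ζ, ζ, 0), ⟨⟨⟨hζ.1.le, hζ.2.le⟩, ⟨hζ.1.le, hζ.2.le⟩, by simp⟩, by simp⟩⟩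
  obtain ⟨⟨z₁, z₂, c⟩, ⟨⟨h1, h2, hc⟩, hsum⟩, hmin⟩ := hK.exists_isMinOn hne
    (f := fun x => x.2.2 * g x.1 + (1 - x.2.2) * g x.2.1) (by fun_prop)
  set V := c * g z₁ + (1 - c) * g z₂ with hV
  have hmin' : ∀ x ∈ Icc (-1 : ℝ) 1, ∀ y ∈ Icc (-1 : ℝ) 1, ∀ t ∈ Icc (0 : ℝ) 1,
      t * x + (1 - t) * y = ζ → V ≤ t * g x + (1 - t) * g y := fun x hx y hy t ht h =>
    hmin (show (x, y, t) ∈ K from ⟨⟨hx, hy, ht⟩, h⟩)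
  -- V is minimal among two-point averages with mean ζ, so no chord across ζ passes below (ζ, V):
  -- slopes from the left are at most slopes to the right. The supremum of the left slopes is then
  -- the slope of a supporting line.
  have hslope : ∀ x ∈ Ico (-1) ζ, ∀ y ∈ Ioc ζ 1,
      (V - g x) / (ζ - x) ≤ (g y - V) / (y - ζ) := fun x hx y hy => by
    have hx' : 0 < ζ - x := sub_pos.2 hx.2
    have hy' : 0 < y - ζ := sub_pos.2 hy.1
    have hxy : 0 < y - x := by linarith
    have := hmin' x ⟨hx.1, by linarith [hζ.2, hx.2]⟩ y ⟨by linarith [hζ.1, hy.1], hy.2⟩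
      ((y - ζ) / (y - x)) ⟨by positivity, (div_le_one hxy).2 (by linarith)⟩
      (by field_simp; ring)
    have e : (y - ζ) / (y - x) * g x + (1 - (y - ζ) / (y - x)) * g y =
      ((y - ζ) * g x + (ζ - x) * g y) / (y - x) := by field_simp; ring
    rw [e, le_div_iff₀ hxy] at this
    rw [div_le_div_iff₀ hx' hy']
    linarith
  set S := (fun x => (V - g x) / (ζ - x)) '' Ico (-1) ζ with hS
  have hSne : S.Nonempty := ⟨_, mem_image_of_mem _ ⟨le_rfl, hζ.1⟩⟩
  have hSle : ∀ y ∈ Ioc ζ 1, ∀ r ∈ S, r ≤ (g y - V) / (y - ζ) := by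
    rintro y hy _ ⟨x, hx, rfl⟩
    exact hslope x hx y hy
  have hbdd : BddAbove S := ⟨_, hSle 1 ⟨hζ.2, le_rfl⟩⟩
  refine ⟨V - sSup S * ζ, sSup S, z₁, z₂, c, h1, h2, hc, hsum, by ring, fun w hw => ?_⟩
  rcases lt_trichotomy w ζ with h | rfl | h
  · have := le_csSup hbdd (mem_image_of_mem _ ⟨hw.1, h⟩)
    rw [div_le_iff₀ (sub_pos.2 h)] at this
    linarith
  · have := hmin' w hw w hw 0 (by simp) (by ring)
    linarith
  · have := csSup_le hSne (hSle w ⟨h, hw.2⟩)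
    rw [le_div_iff₀ (sub_pos.2 h)] at this
    linarith

/-- The points of `[-1, 1]` where `g` coincides with the affine function `w ↦ m + s * w`: at most
one point and one endpoint. -/
def TouchesAtMost (g : ℝ → ℝ) (m s : ℝ) : Prop :=
  ∃ z e : ℝ, (e = 1 ∨ e = -1) ∧ ∀ w ∈ Icc (-1 : ℝ) 1, g w = m + s * w → w = z ∨ w = e

section Touching

variable {g : ℝ → ℝ} {m s : ℝ}

theorem touchesAtMost_of_strictConvexOn (hg : StrictConvexOn ℝ (Icc (-1) 1) g)
    (hle : ∀ w ∈ Icc (-1 : ℝ) 1, m + s * w ≤ g w) : TouchesAtMost g m s := by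
  by_cases h : ∃ z ∈ Icc (-1 : ℝ) 1, g z = m + s * z
  · obtain ⟨z, hz, hgz⟩ := h
    refine ⟨z, 1, Or.inl rfl, fun w hw hgw => Or.inl ?_⟩
    by_contra hne
    have h1 := hg.2 hw hz hne (half_pos one_pos) (half_pos one_pos) (by norm_num)
    have h2 := hle _ (convex_Icc _ _ hw hz (half_pos (one_pos (α := ℝ))).le
      (half_pos one_pos).le (by norm_num))
    rw [hgw, hgz] at h1
    simp only [smul_eq_mul] at h1 h2
    linarith
  · exact ⟨1, 1, Or.inl rfl, fun w hw hgw => absurd ⟨w, hw, hgw⟩ h⟩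

/-- An interior point lies strictly above the chord over [-1, 1], which is itself above the line;
only the two endpoints can be contacts. -/
theorem touchesAtMost_of_strictConcaveOn (hg : StrictConcaveOn ℝ (Icc (-1) 1) g)
    (hle : ∀ w ∈ Icc (-1 : ℝ) 1, m + s * w ≤ g w) : TouchesAtMost g m s := by
  refine ⟨1, -1, Or.inr rfl, fun w hw hgw => ?_⟩
  by_contra! hne
  have h1 : w < 1 := lt_of_le_of_ne hw.2 hne.1
  have h2 : -1 < w := lt_of_le_of_ne hw.1 (Ne.symm hne.2)
  have hl : (-1 : ℝ) ∈ Icc (-1 : ℝ) 1 := by norm_num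
  have hr : (1 : ℝ) ∈ Icc (-1 : ℝ) 1 := by norm_num
  have h3 := hg.2 hl hr (by norm_num) (show 0 < (1 - w) / 2 by linarith)
    (show 0 < (1 + w) / 2 by linarith) (by ring)
  have e : ((1 - w) / 2) • (-1 : ℝ) + ((1 + w) / 2) • (1 : ℝ) = w := by
    simp only [smul_eq_mul]; ring
  rw [e, hgw] at h3
  simp only [smul_eq_mul] at h3
  nlinarith [hle _ hl, hle _ hr]

/-- An interior contact is a tangency, so g' = s there, and Rolle gives another point with g' = s
between any two contacts. Two interior contacts, or one together with both endpoints, would produce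
three solutions of g' = s, hence two zeros of g''. -/
theorem touchesAtMost_of_hasDerivAt {g' g'' : ℝ → ℝ} (hc : Continuous g)
    (h1 : ∀ w ∈ Ioo (-1 : ℝ) 1, HasDerivAt g (g' w) w)
    (h2 : ∀ w ∈ Ioo (-1 : ℝ) 1, HasDerivAt g' (g'' w) w)
    (hinj : ∀ x ∈ Ioo (-1 : ℝ) 1, ∀ y ∈ Ioo (-1 : ℝ) 1, g'' x = 0 → g'' y = 0 → x = y)
    (hle : ∀ w ∈ Icc (-1 : ℝ) 1, m + s * w ≤ g w) : TouchesAtMost g m s := by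
  have rolle' : ∀ x ∈ Ioo (-1 : ℝ) 1, ∀ y ∈ Ioo (-1 : ℝ) 1, x < y → g' x = s → g' y = s →
      ∃ z ∈ Ioo x y, g'' z = 0 := fun x hx y hy hxy hgx hgy => by
    have hsub : ∀ w ∈ Icc x y, w ∈ Ioo (-1 : ℝ) 1 := fun w hw =>
      ⟨hx.1.trans_le hw.1, hw.2.trans_lt hy.2⟩
    exact exists_hasDerivAt_eq_zero hxy
      (fun w hw => (h2 w (hsub w hw)).continuousAt.continuousWithinAt) (hgx.trans hgy.symm)
      fun w hw => h2 w (hsub w (Ioo_subset_Icc_self hw))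
  have no_three : ∀ x y z : ℝ, -1 < x → x < y → y < z → z < 1 → g' x = s → g' y = s →
      g' z = s → False := fun x y z hx hxy hyz hz ex ey ez => by
    obtain ⟨p, hp, hp0⟩ := rolle' x ⟨hx, by linarith⟩ y ⟨by linarith, by linarith⟩ hxy ex ey
    obtain ⟨q, hq, hq0⟩ := rolle' y ⟨by linarith, by linarith⟩ z ⟨by linarith, hz⟩ hyz ey ez
    have := hinj p ⟨by linarith [hp.1], by linarith [hp.2]⟩ q
      ⟨by linarith [hq.1], by linarith [hq.2]⟩ hp0 hq0
    linarith [hp.2, hq.1]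
  have rolle : ∀ x y : ℝ, -1 ≤ x → x < y → y ≤ 1 → g x = m + s * x → g y = m + s * y →
      ∃ z ∈ Ioo x y, g' z = s := fun x y hx hxy hy ex ey => by
    obtain ⟨z, hz, hz0⟩ := exists_hasDerivAt_eq_zero (f := fun w => g w - s * w)
      (f' := fun w => g' w - s) hxy (by fun_prop) (by simp only [ex, ey]; ring)
      fun w hw => ((h1 w ⟨by linarith [hw.1], by linarith [hw.2]⟩).sub
        ((hasDerivAt_id w).const_mul s)).congr_deriv (by simp)
    exact ⟨z, hz, sub_eq_zero.1 hz0⟩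
  have crit : ∀ z ∈ Ioo (-1 : ℝ) 1, g z = m + s * z → g' z = s := fun z hz ez => by
    have hmin : IsLocalMin (fun w => g w - s * w) z := by
      filter_upwards [Ioo_mem_nhds hz.1 hz.2] with w hw
      linarith [hle w (Ioo_subset_Icc_self hw)]
    have := hmin.hasDerivAt_eq_zero ((h1 z hz).sub ((hasDerivAt_id z).const_mul s))
    linarith
  have no_two : ∀ x y : ℝ, -1 < x → x < y → y < 1 → g x = m + s * x → g y = m + s * y → False :=
    fun x y hx hxy hy ex ey => by
    obtain ⟨z, hz, ez⟩ := rolle x y hx.le hxy hy.le ex ey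
    exact no_three x z y hx hz.1 hz.2 hy (crit x ⟨hx, by linarith⟩ ex) ez
      (crit y ⟨by linarith, hy⟩ ey)
  by_cases h : ∃ z ∈ Ioo (-1 : ℝ) 1, g z = m + s * z
  · obtain ⟨z, hz, ez⟩ := h
    have hin : ∀ w ∈ Ioo (-1 : ℝ) 1, g w = m + s * w → w = z := fun w hw ew => by
      rcases lt_trichotomy w z with h | h | h
      · exact (no_two w z hw.1 h hz.2 ew ez).elim
      · exact h
      · exact (no_two z w hz.1 h hw.2 ez ew).elim
    by_cases hm : g (-1) = m + s * (-1)
    · refine ⟨z, -1, Or.inr rfl, fun w hw ew => ?_⟩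
      rcases hw.1.eq_or_lt with h | h
      · exact Or.inr h.symm
      rcases hw.2.eq_or_lt with rfl | h'
      · obtain ⟨p, hp, ep⟩ := rolle (-1) z le_rfl hz.1 hz.2.le hm ez
        obtain ⟨q, hq, eq⟩ := rolle z 1 hz.1.le hz.2 le_rfl ez ew
        exact (no_three p z q hp.1 hp.2 hq.1 hq.2 ep (crit z hz ez) eq).elim
      · exact Or.inl (hin w ⟨h, h'⟩ ew)
    · refine ⟨z, 1, Or.inl rfl, fun w hw ew => ?_⟩
      rcases hw.1.eq_or_lt with rfl | h
      · exact absurd ew hm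
      rcases hw.2.eq_or_lt with h' | h'
      · exact Or.inr h'
      · exact Or.inl (hin w ⟨h, h'⟩ ew)
  · refine ⟨1, -1, Or.inr rfl, fun w hw ew => ?_⟩
    by_contra! hne
    exact h ⟨w, ⟨lt_of_le_of_ne hw.1 (Ne.symm hne.2), lt_of_le_of_ne hw.2 hne.1⟩, ew⟩

end Touching

/-- An affine function below the entropy along a nonconstant conic touches it in at most one
point and one endpoint. -/
theorem touchesAtMost_blochEntropy {A B C m s : ℝ} (hAB : A ≠ 0 ∨ B ≠ 0)
    (hq : ∀ z ∈ Icc (-1 : ℝ) 1, A * z ^ 2 + 2 * B * z + C ∈ Icc (0 : ℝ) 1)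
    (hle : ∀ w ∈ Icc (-1 : ℝ) 1, m + s * w ≤ blochEntropy (A * w ^ 2 + 2 * B * w + C)) :
    TouchesAtMost (fun z => blochEntropy (A * z ^ 2 + 2 * B * z + C)) m s := by
  rcases le_or_gt 0 A with hA | hA
  · exact touchesAtMost_of_strictConcaveOn (strictConcaveOn_blochEntropy_comp hA hAB hq) hle
  obtain ⟨κ, hκ, rfl⟩ : ∃ κ : ℝ, 0 < κ ∧ A = -κ := ⟨-A, by linarith, by ring⟩
  obtain ⟨v, rfl⟩ : ∃ v, B = κ * v := ⟨B / κ, by field_simp⟩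
  obtain ⟨M, rfl⟩ : ∃ M, C = M - κ * v ^ 2 := ⟨C + κ * v ^ 2, by ring⟩
  have e : ∀ z : ℝ, -κ * z ^ 2 + 2 * (κ * v) * z + (M - κ * v ^ 2) = M - κ * (z - v) ^ 2 :=
    fun z => by ring
  simp only [e] at hq hle ⊢
  -- If the vertex v lies in [-1, 1], its value M is a value of the conic, so M ≤ 1 and the entropy
  -- is strictly convex.
  by_cases hv : v ∈ Icc (-1 : ℝ) 1
  · have hM : M ≤ 1 := by simpa using (hq v hv).2
    refine touchesAtMost_of_strictConvexOn ?_ hle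
    -- 1 + |v| is the distance from v to the farther endpoint, where the conic is still nonnegative.
    have hR : 0 ≤ M - κ * (1 + |v|) ^ 2 := by
      rcases abs_cases v with ⟨h, -⟩ | ⟨h, -⟩ <;> rw [h]
      · exact (hq (-1) (by norm_num)).1.trans_eq (by ring)
      · exact (hq 1 (by norm_num)).1.trans_eq (by ring)
    have := strictConvexOn_blochEntropy_conic hκ hM hR
    refine ⟨convex_Icc _ _, fun x hx y hy hxy a b ha hb hab => ?_⟩
    have hmem : ∀ z ∈ Icc (-1 : ℝ) 1, z - v ∈ Icc (-(1 + |v|)) (1 + |v|) := fun z hz =>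
      ⟨by linarith [hz.1, le_abs_self v], by linarith [hz.2, neg_abs_le v]⟩
    have h := this.2 (hmem x hx) (hmem y hy) (fun h => hxy (by linarith)) ha hb hab
    have e' : a • (x - v) + b • (y - v) = a • x + b • y - v := by
      simp only [smul_eq_mul]
      linear_combination (-v) * hab
    rwa [e'] at h
  · have hout : v < -1 ∨ 1 < v := by
      by_contra! h
      exact hv ⟨h.1, h.2⟩
    -- With the vertex outside, the conic is strictly monotone, so interior values lie strictly
    -- between the endpoint values.
    have hb : ∀ z ∈ Ioo (-1 : ℝ) 1, 0 < M - κ * (z - v) ^ 2 ∧ M - κ * (z - v) ^ 2 < 1 := by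
      intro z hz
      have hl := hq (-1) (by norm_num)
      have hr := hq 1 (by norm_num)
      obtain ⟨hz1, hz2⟩ := hz
      rcases hout with h | h
      · have h1 : (z - v) ^ 2 < (1 - v) ^ 2 := by nlinarith
        have h2 : (-1 - v) ^ 2 < (z - v) ^ 2 := by nlinarith
        constructor <;> nlinarith [hl.2, hr.1]
      · have h1 : (1 - v) ^ 2 < (z - v) ^ 2 := by nlinarith
        have h2 : (z - v) ^ 2 < (-1 - v) ^ 2 := by nlinarith
        constructor <;> nlinarith [hl.1, hr.2]
    refine touchesAtMost_of_hasDerivAt (g' := fun z => conicDeriv κ M (z - v))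
      (g'' := fun z => κ / (1 - (M - κ * (z - v) ^ 2)) *
        (1 - M * curvatureRatio √(M - κ * (z - v) ^ 2)))
      (continuous_blochEntropy.comp (by fun_prop)) (fun w hw => ?_) (fun w hw => ?_)
      (fun x hx y hy ex ey => ?_) hle
    · exact HasDerivAt.comp_sub_const w v (hasDerivAt_blochEntropy_conic (hb w hw).1 (hb w hw).2)
    · exact HasDerivAt.comp_sub_const w v (hasDerivAt_conicDeriv (hb w hw).1 (hb w hw).2)
    -- z - v has constant sign on the interval, so its square determines z.
    · have := conicDeriv_deriv_injective hκ (s := x - v) (t := y - v) (fun h => ?_)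
        (hb x hx).1 (hb x hx).2 (hb y hy).1 (hb y hy).2 ex ey
      · linarith
      · rcases sq_eq_sq_iff_eq_or_eq_neg.1 h with h | h
        · exact h
        · rcases hout with h' | h' <;> linarith [hx.1, hx.2, hy.1, hy.2]

open ComplexConjugate

/-! ### Positive operators, rank-one POVMs and entropy on one qubit. -/

section Qubit

variable {E : Qubit}

theorem PosSemidef.entries (hE : E.PosSemidef) :
    E 0 0 = ((E 0 0).re : ℂ) ∧ E 1 1 = ((E 1 1).re : ℂ) ∧ E 1 0 = conj (E 0 1) ∧
      0 ≤ (E 0 0).re ∧ 0 ≤ (E 1 1).re ∧ ‖E 0 1‖ ^ 2 ≤ (E 0 0).re * (E 1 1).re := by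
  have h0 := Complex.nonneg_iff.1 (hE.diag_nonneg (i := 0))
  have h1 := Complex.nonneg_iff.1 (hE.diag_nonneg (i := 1))
  have e0 : E 0 0 = ((E 0 0).re : ℂ) := Complex.ext rfl (by simp [← h0.2])
  have e1 : E 1 1 = ((E 1 1).re : ℂ) := Complex.ext rfl (by simp [← h1.2])
  have e10 : E 1 0 = conj (E 0 1) := (hE.1.apply 1 0).symm
  refine ⟨e0, e1, e10, h0.1, h1.1, ?_⟩
  have hd := hE.det_nonneg
  rw [Matrix.det_fin_two, e0, e1, e10, Complex.mul_conj, Complex.normSq_eq_norm_sq] at hd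
  norm_cast at hd
  linarith

theorem det_eq_zero_of_rank_eq_one (h : E.rank = 1) : E.det = 0 := by
  by_contra hd
  have := Matrix.rank_of_isUnit E ((Matrix.isUnit_iff_isUnit_det E).2 (isUnit_iff_ne_zero.2 hd))
  simp [h] at this

theorem PosSemidef.norm_sq_eq_of_rank_eq_one (hE : E.PosSemidef) (h : E.rank = 1) :
    ‖E 0 1‖ ^ 2 = (E 0 0).re * (E 1 1).re := by
  obtain ⟨e0, e1, e10, -, -, -⟩ := PosSemidef.entries hE
  have hd := det_eq_zero_of_rank_eq_one h
  rw [Matrix.det_fin_two, e0, e1, e10, Complex.mul_conj, Complex.normSq_eq_norm_sq] at hd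
  norm_cast at hd
  linarith

/-- Cayley–Hamilton: E² = (tr E) E - (det E) 1. -/
theorem mul_self_eq_of_det_trace (hd : E.det = 0) (ht : E 0 0 + E 1 1 = 1) : E * E = E := by
  rw [Matrix.det_fin_two] at hd
  ext i j
  rw [Matrix.mul_apply, Fin.sum_univ_two]
  fin_cases i <;> fin_cases j <;> simp only [Fin.zero_eta, Fin.mk_one]
  · linear_combination E 0 0 * ht - hd
  · linear_combination E 0 1 * ht
  · linear_combination E 1 0 * ht
  · linear_combination E 1 1 * ht - hd

/-- A two-element POVM with elements of rank one is a von Neumann measurement. -/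
theorem POVM.isVonNeumann_of_rank (M : POVM 2) (h : ∀ i, (M.elem i).rank = 1) :
    M.IsVonNeumann := by
  refine ⟨rfl, fun i => ⟨h i, mul_self_eq_of_det_trace (det_eq_zero_of_rank_eq_one (h i)) ?_⟩⟩
  have hs := M.sum_eq_one
  rw [Fin.sum_univ_two] at hs
  have h00 := congrFun (congrFun hs 0) 0
  have h01 := congrFun (congrFun hs 0) 1
  have h10 := congrFun (congrFun hs 1) 0
  have h11 := congrFun (congrFun hs 1) 1
  simp only [Matrix.add_apply, Matrix.one_apply, Fin.isValue] at h00 h01 h10 h11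
  norm_num at h00 h01 h10 h11
  have d0 := det_eq_zero_of_rank_eq_one (h 0)
  have d1 := det_eq_zero_of_rank_eq_one (h 1)
  rw [Matrix.det_fin_two] at d0 d1
  have e00 := eq_sub_of_add_eq' h00
  have e01 := eq_sub_of_add_eq' h01
  have e10 := eq_sub_of_add_eq' h10
  have e11 := eq_sub_of_add_eq' h11
  rw [e00, e01, e10, e11] at d1
  -- det(1 - E) = 1 - tr E + det E, and both determinants vanish.
  have ht : M.elem 0 0 0 + M.elem 0 1 1 = 1 := by linear_combination d0 - d1
  fin_cases i
  · exact ht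
  · simp only [Fin.mk_one]
    rw [e00, e11]
    linear_combination -ht

theorem POVM.ne_zero {k : ℕ} (M : POVM k) (h : ∀ i, (M.elem i).rank = 1) : k ≠ 0 ∧ k ≠ 1 := by
  constructor
  · rintro rfl
    have := M.sum_eq_one
    simp at this
  · rintro rfl
    have := M.sum_eq_one
    rw [Fin.sum_univ_one] at this
    have h1 := h 0
    rw [this, Matrix.rank_one] at h1
    simp at h1

/-- The von Neumann entropy of a qubit state in terms of the squared length of its Bloch
vector. -/
theorem vonNeumannEntropy_eq (h : E.IsHermitian) (ht : (E 0 0).re + (E 1 1).re = 1) :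
    vonNeumannEntropy E =
      blochEntropy (((E 0 0).re - (E 1 1).re) ^ 2 + 4 * ‖E 0 1‖ ^ 2) / log 2 := by
  have e0 : E 0 0 = ((E 0 0).re : ℂ) := (Complex.conj_eq_iff_re.1 (h.apply 0 0)).symm
  have e1 : E 1 1 = ((E 1 1).re : ℂ) := (Complex.conj_eq_iff_re.1 (h.apply 1 1)).symm
  have e10 : E 1 0 = conj (E 0 1) := (h.apply 1 0).symm
  rw [vonNeumannEntropy, dif_pos h, Fin.sum_univ_two]
  have htr := h.trace_eq_sum_eigenvalues
  have hdet := h.det_eq_prod_eigenvalues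
  rw [Matrix.trace_fin_two, Fin.sum_univ_two, e0, e1] at htr
  rw [Matrix.det_fin_two, Fin.prod_univ_two, e0, e1, e10, Complex.mul_conj,
    Complex.normSq_eq_norm_sq] at hdet
  set x := h.eigenvalues 0
  set y := h.eigenvalues 1
  have htr' : (E 0 0).re + (E 1 1).re = x + y := by
    have h' : ((E 0 0).re : ℂ) + (E 1 1).re = (x : ℂ) + y := htr
    exact_mod_cast h'
  have hdet' : (E 0 0).re * (E 1 1).re - ‖E 0 1‖ ^ 2 = x * y := by
    have h' : ((E 0 0).re : ℂ) * (E 1 1).re - (‖E 0 1‖ ^ 2 : ℝ) = (x : ℂ) * y := hdet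
    exact_mod_cast h'
  have hy : y = 1 - x := by linarith
  have hq : ((E 0 0).re - (E 1 1).re) ^ 2 + 4 * ‖E 0 1‖ ^ 2 = (x - y) ^ 2 := by
    linear_combination ((E 0 0).re + (E 1 1).re + (x + y)) * htr' - 4 * hdet'
  rw [hq, blochEntropy, sqrt_sq_eq_abs, hy]
  congr 1
  rw [← binEntropy_eq_negMulLog_add_negMulLog_one_sub]
  -- Either eigenvalue may be the larger one; `binEntropy` is symmetric under p ↦ 1 - p.
  rcases abs_cases (x - (1 - x)) with ⟨h', -⟩ | ⟨h', -⟩ <;> rw [h']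
  · congr 1; ring
  · rw [← binEntropy_one_sub]; congr 1; ring

end Qubit

/-- A phase that aligns the two contributions to the off-diagonal entry of the steered states. -/
theorem exists_phase (u v : ℂ) : ∃ ω : ℂ, ‖ω‖ = 1 ∧ ∀ ξ : ℂ,
    ‖ξ * ω * conj v + conj (ξ * ω) * u‖ ^ 2 =
      ((‖u‖ + ‖v‖) * ξ.re) ^ 2 + ((‖u‖ - ‖v‖) * ξ.im) ^ 2 := by
  -- The mean of the arguments of u and v gives `ω * conj v` and `conj ω * u` the common phase η. If
  -- u or v is zero, the conventional value of its argument is harmless.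
  set ω : ℂ := Complex.exp (((u.arg + v.arg) / 2 : ℝ) * Complex.I) with hω
  set η : ℂ := Complex.exp (((u.arg - v.arg) / 2 : ℝ) * Complex.I) with hη
  have hconj : ∀ θ : ℝ, conj (Complex.exp (θ * Complex.I)) = Complex.exp ((-θ : ℝ) * Complex.I) :=
    fun θ => by rw [← Complex.exp_conj]; simp
  have hv : ω * conj v = ‖v‖ * η := by
    conv_lhs => rw [← Complex.norm_mul_exp_arg_mul_I v]
    rw [map_mul, hconj, Complex.conj_ofReal, hω, hη, mul_left_comm, ← Complex.exp_add]
    congr 2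
    push_cast
    ring
  have hu : conj ω * u = ‖u‖ * η := by
    conv_lhs => rw [← Complex.norm_mul_exp_arg_mul_I u]
    rw [hω, hconj, hη, mul_left_comm, ← Complex.exp_add]
    congr 2
    push_cast
    ring
  refine ⟨ω, Complex.norm_exp_ofReal_mul_I _, fun ξ => ?_⟩
  have e : ξ * ω * conj v + conj (ξ * ω) * u = (ξ * ‖v‖ + conj ξ * ‖u‖) * η := by
    rw [map_mul, mul_assoc, hv, mul_assoc, hu]
    ring
  rw [e, norm_mul, Complex.norm_exp_ofReal_mul_I, mul_one, Complex.sq_norm, Complex.normSq_apply]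
  simp
  ring

/-! ### Outcome probabilities and conditional states of an X state. -/

section Steering

variable {ρ : TwoQubit}

theorem IsXState.entries (hρ : IsXState ρ) :
    0 ≤ (ρ (0, 0) (0, 0)).re ∧ 0 ≤ (ρ (0, 1) (0, 1)).re ∧ 0 ≤ (ρ (1, 0) (1, 0)).re ∧
      0 ≤ (ρ (1, 1) (1, 1)).re ∧
      (ρ (0, 0) (0, 0)).re + (ρ (0, 1) (0, 1)).re +
        ((ρ (1, 0) (1, 0)).re + (ρ (1, 1) (1, 1)).re) = 1 ∧
      ‖ρ (0, 0) (1, 1)‖ ^ 2 ≤ (ρ (0, 0) (0, 0)).re * (ρ (1, 1) (1, 1)).re ∧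
      ‖ρ (0, 1) (1, 0)‖ ^ 2 ≤ (ρ (0, 1) (0, 1)).re * (ρ (1, 0) (1, 0)).re := by
  -- An X state is a direct sum of two 2 × 2 blocks; positivity of each block bounds u and v.
  have h1 := PosSemidef.entries (hρ.posSemidef.submatrix ![(0, 0), (1, 1)])
  have h2 := PosSemidef.entries (hρ.posSemidef.submatrix ![(0, 1), (1, 0)])
  simp at h1 h2
  have ht := congrArg Complex.re hρ.trace_eq_one
  simp [Matrix.trace, Fintype.sum_prod_type] at ht
  exact ⟨h1.2.2.2.1, h2.2.2.2.1, h2.2.2.2.2.1, h1.2.2.2.2.1, by linarith, h1.2.2.2.2.2,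
    h2.2.2.2.2.2⟩

/-- The numerator of the vertical Bloch component of the conditional state. -/
noncomputable def steeredHeight (ρ : TwoQubit) (E : Qubit) : ℝ :=
  ((ρ (0, 0) (0, 0)).re - (ρ (0, 1) (0, 1)).re) * (E 0 0).re +
    ((ρ (1, 0) (1, 0)).re - (ρ (1, 1) (1, 1)).re) * (E 1 1).re

/-- The off-diagonal entry of the unnormalized steered state. -/
noncomputable def steeredOffDiag (ρ : TwoQubit) (E : Qubit) : ℂ :=
  E 0 1 * conj (ρ (0, 1) (1, 0)) + conj (E 0 1) * ρ (0, 0) (1, 1)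

/-- The squared length of the Bloch vector of the conditional state. -/
noncomputable def conditionalBlochSq (ρ : TwoQubit) (E : Qubit) : ℝ :=
  (steeredHeight ρ E ^ 2 + 4 * ‖steeredOffDiag ρ E‖ ^ 2) / outcomeProb ρ E ^ 2

theorem steered_apply (hρ : IsXState ρ) {E : Qubit} (hE : E.PosSemidef) :
    steered ρ E 0 0 = (((ρ (0, 0) (0, 0)).re * (E 0 0).re + (ρ (1, 0) (1, 0)).re * (E 1 1).re : ℝ) :
      ℂ) ∧
    steered ρ E 1 1 = (((ρ (0, 1) (0, 1)).re * (E 0 0).re + (ρ (1, 1) (1, 1)).re * (E 1 1).re : ℝ) :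
      ℂ) ∧
    steered ρ E 0 1 = steeredOffDiag ρ E ∧ steered ρ E 1 0 = conj (steeredOffDiag ρ E) := by
  obtain ⟨e0, e1, e10, -, -, -⟩ := PosSemidef.entries hE
  have hr : ∀ i j : Fin 2, ρ (i, j) (i, j) = ((ρ (i, j) (i, j)).re : ℂ) := fun i j =>
    (Complex.conj_eq_iff_re.1 (hρ.posSemidef.1.apply (i, j) (i, j))).symm
  have hv : ρ (1, 0) (0, 1) = conj (ρ (0, 1) (1, 0)) :=
    (hρ.posSemidef.1.apply (1, 0) (0, 1)).symm
  have hu : ρ (1, 1) (0, 0) = conj (ρ (0, 0) (1, 1)) :=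
    (hρ.posSemidef.1.apply (1, 1) (0, 0)).symm
  have z1 := hρ.eq_zero 0 0 1 0 (by decide) (by decide)
  have z2 := hρ.eq_zero 1 0 0 0 (by decide) (by decide)
  have z3 := hρ.eq_zero 0 1 1 1 (by decide) (by decide)
  have z4 := hρ.eq_zero 1 1 0 1 (by decide) (by decide)
  have z5 := hρ.eq_zero 0 0 0 1 (by decide) (by decide)
  have z6 := hρ.eq_zero 0 1 0 0 (by decide) (by decide)
  have z7 := hρ.eq_zero 1 0 1 1 (by decide) (by decide)
  have z8 := hρ.eq_zero 1 1 1 0 (by decide) (by decide)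
  refine ⟨?_, ?_, ?_, ?_⟩ <;>
    simp [steered, partialTraceA, Matrix.mul_apply, Fintype.sum_prod_type, Matrix.one_apply,
      steeredOffDiag, z1, z2, z3, z4, z5, z6, z7, z8, e10, hu, hv]
  · rw [e0, e1, hr 0 0, hr 1 0]; simp; ring
  · rw [e0, e1, hr 0 1, hr 1 1]; simp; ring
  · ring

theorem outcomeProb_eq (hρ : IsXState ρ) {E : Qubit} (hE : E.PosSemidef) :
    outcomeProb ρ E = ((ρ (0, 0) (0, 0)).re + (ρ (0, 1) (0, 1)).re) * (E 0 0).re +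
      ((ρ (1, 0) (1, 0)).re + (ρ (1, 1) (1, 1)).re) * (E 1 1).re := by
  obtain ⟨h0, h1, -, -⟩ := steered_apply hρ hE
  have : ((E ⊗ₖ (1 : Qubit)) * ρ).trace = steered ρ E 0 0 + steered ρ E 1 1 := by
    simp only [Matrix.trace, Fintype.sum_prod_type, Fin.sum_univ_two, steered, partialTraceA,
      Matrix.of_apply, Matrix.diag_apply]
    ring
  rw [outcomeProb, this, h0, h1, ← Complex.ofReal_add, Complex.ofReal_re]
  ring

theorem outcomeProb_nonneg (hρ : IsXState ρ) {E : Qubit} (hE : E.PosSemidef) :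
    0 ≤ outcomeProb ρ E := by
  rw [outcomeProb_eq hρ hE]
  obtain ⟨-, -, -, h0, h1, -⟩ := PosSemidef.entries hE
  obtain ⟨ha, hb, hc, hd, -, -, -⟩ := hρ.entries
  positivity

theorem outcomeProb_mul_vonNeumannEntropy (hρ : IsXState ρ) {E : Qubit} (hE : E.PosSemidef) :
    outcomeProb ρ E * vonNeumannEntropy (conditionalState ρ E) =
      outcomeProb ρ E * blochEntropy (conditionalBlochSq ρ E) / log 2 := by
  rcases (outcomeProb_nonneg hρ hE).eq_or_lt with h | hp
  · simp [← h]
  obtain ⟨h0, h1, h01, h10⟩ := steered_apply hρ hE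
  have hp' := hp.ne'
  have hpe := outcomeProb_eq hρ hE
  have hH : (conditionalState ρ E).IsHermitian := by
    refine Matrix.IsHermitian.ext fun i j => ?_
    fin_cases i <;> fin_cases j <;>
      simp [conditionalState, h0, h1, h01, h10]
  have c0 : (conditionalState ρ E 0 0).re = (outcomeProb ρ E)⁻¹ *
      ((ρ (0, 0) (0, 0)).re * (E 0 0).re + (ρ (1, 0) (1, 0)).re * (E 1 1).re) := by
    rw [conditionalState, Matrix.smul_apply, h0, smul_eq_mul, ← Complex.ofReal_inv,
      ← Complex.ofReal_mul, Complex.ofReal_re]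
  have c1 : (conditionalState ρ E 1 1).re = (outcomeProb ρ E)⁻¹ *
      ((ρ (0, 1) (0, 1)).re * (E 0 0).re + (ρ (1, 1) (1, 1)).re * (E 1 1).re) := by
    rw [conditionalState, Matrix.smul_apply, h1, smul_eq_mul, ← Complex.ofReal_inv,
      ← Complex.ofReal_mul, Complex.ofReal_re]
  have c01 : ‖conditionalState ρ E 0 1‖ = (outcomeProb ρ E)⁻¹ * ‖steeredOffDiag ρ E‖ := by
    rw [conditionalState, Matrix.smul_apply, h01, smul_eq_mul, norm_mul, norm_inv,
      Complex.norm_real, norm_of_nonneg hp.le]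
  rw [vonNeumannEntropy_eq hH, mul_div_assoc]
  · congr 3
    rw [c0, c1, c01, conditionalBlochSq, steeredHeight]
    field_simp
    ring
  · rw [c0, c1, ← mul_add, inv_mul_eq_one₀ hp', hpe]
    ring

theorem averageEntropy_mul_log_two (hρ : IsXState ρ) {k : ℕ} (M : POVM k) :
    averageEntropy ρ M * log 2 =
      ∑ i, outcomeProb ρ (M.elem i) * blochEntropy (conditionalBlochSq ρ (M.elem i)) := by
  have h2 : log 2 ≠ 0 := (log_pos one_lt_two).ne'
  rw [averageEntropy, Finset.sum_mul]
  refine Finset.sum_congr rfl fun i _ => ?_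
  rw [outcomeProb_mul_vonNeumannEntropy hρ (M.posSemidef i), div_mul_cancel₀ _ h2]

theorem POVM.sum_diag {k : ℕ} (M : POVM k) (j : Fin 2) : ∑ i, (M.elem i j j).re = 1 := by
  have := congrArg Complex.re (congrFun (congrFun M.sum_eq_one j) j)
  simpa [Matrix.sum_apply] using this

theorem sum_outcomeProb (hρ : IsXState ρ) {k : ℕ} (M : POVM k) :
    ∑ i, outcomeProb ρ (M.elem i) = 1 := by
  simp only [fun i => outcomeProb_eq hρ (M.posSemidef i)]
  rw [Finset.sum_add_distrib, ← Finset.mul_sum, ← Finset.mul_sum, M.sum_diag, M.sum_diag]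
  linarith [hρ.entries.2.2.2.2.1]

end Steering


/-! ### The steering ellipse and the affine lower bound. -/

section Conic

variable {ρ : TwoQubit}

/-- The signed vertical semiaxis of the steering ellipse. -/
noncomputable def slope (ρ : TwoQubit) : ℝ :=
  ((ρ (0, 0) (0, 0)).re * (ρ (1, 1) (1, 1)).re - (ρ (0, 1) (0, 1)).re * (ρ (1, 0) (1, 0)).re)
    / margDet ρ

/-- The squared distance from the origin to the point of the steering ellipse with parameter `z`,
the height of the corresponding point of the Bloch sphere of `A`. -/
noncomputable def conic (ρ : TwoQubit) (z : ℝ) : ℝ :=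
  semiaxis₁ ρ ^ 2 * (1 - z ^ 2) + (centre ρ + slope ρ * z) ^ 2

/-- The height of the point of the Bloch ball of `A` that belongs to the element `E`, after the
local filtering that turns POVMs into decompositions of the marginal of `A`. -/
noncomputable def height (ρ : TwoQubit) (E : Qubit) : ℝ :=
  (((ρ (0, 0) (0, 0)).re + (ρ (0, 1) (0, 1)).re) * (E 0 0).re -
      ((ρ (1, 0) (1, 0)).re + (ρ (1, 1) (1, 1)).re) * (E 1 1).re) / outcomeProb ρ E

/-- The vertical Bloch component of the marginal of `A`. -/
noncomputable def marginalHeight (ρ : TwoQubit) : ℝ :=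
  ((ρ (0, 0) (0, 0)).re + (ρ (0, 1) (0, 1)).re) - ((ρ (1, 0) (1, 0)).re + (ρ (1, 1) (1, 1)).re)

theorem abs_slope (hm : 0 < margDet ρ) : |slope ρ| = semiaxis₃ ρ := by
  rw [slope, semiaxis₃, abs_div, abs_of_pos hm]

theorem conic_eq (z : ℝ) : conic ρ z = (slope ρ ^ 2 - semiaxis₁ ρ ^ 2) * z ^ 2 +
    2 * (centre ρ * slope ρ) * z + (semiaxis₁ ρ ^ 2 + centre ρ ^ 2) := by
  rw [conic]; ring

theorem continuous_blochEntropy_conic : Continuous fun z => blochEntropy (conic ρ z) := by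
  refine continuous_blochEntropy.comp ?_
  unfold conic
  fun_prop

theorem conic_ne_constant (hm : 0 < margDet ρ) (h : ¬ HasConstantEntropyEllipse ρ) :
    slope ρ ^ 2 - semiaxis₁ ρ ^ 2 ≠ 0 ∨ centre ρ * slope ρ ≠ 0 := by
  by_contra! hc
  obtain ⟨h1, h2⟩ := hc
  have hs1 : 0 ≤ semiaxis₁ ρ := by unfold semiaxis₁; positivity
  have h3 : semiaxis₁ ρ = semiaxis₃ ρ := by
    rw [← abs_slope hm, ← abs_of_nonneg hs1]
    exact (sq_eq_sq_iff_abs_eq_abs _ _).1 (by linarith)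
  refine h ?_
  rcases mul_eq_zero.1 h2 with h4 | h4
  · exact Or.inr ⟨h3, h4⟩
  · have : semiaxis₃ ρ = 0 := by rw [← abs_slope hm, h4, abs_zero]
    exact Or.inl ⟨h3.trans this, this⟩

theorem marginals_pos (hρ : IsXState ρ) (hm : 0 < margDet ρ) :
    0 < (ρ (0, 0) (0, 0)).re + (ρ (0, 1) (0, 1)).re ∧
      0 < (ρ (1, 0) (1, 0)).re + (ρ (1, 1) (1, 1)).re := by
  obtain ⟨ha, hb, hc, hd, -, -, -⟩ := hρ.entries
  have hα : 0 ≤ (ρ (0, 0) (0, 0)).re + (ρ (0, 1) (0, 1)).re := by positivity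
  exact ⟨pos_of_mul_pos_left hm (by positivity), pos_of_mul_pos_right hm hα⟩

/-- The squared Bloch length on the ellipse for an outcome with diagonal entries `s` and `t`. -/
theorem conic_div (hρ : IsXState ρ) (hm : 0 < margDet ρ) {s t p z : ℝ} (hp : p ≠ 0)
    (h0 : ((ρ (0, 0) (0, 0)).re + (ρ (0, 1) (0, 1)).re) * s = p * (1 + z) / 2)
    (h1 : ((ρ (1, 0) (1, 0)).re + (ρ (1, 1) (1, 1)).re) * t = p * (1 - z) / 2) :
    conic ρ z = ((((ρ (0, 0) (0, 0)).re - (ρ (0, 1) (0, 1)).re) * s +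
      ((ρ (1, 0) (1, 0)).re - (ρ (1, 1) (1, 1)).re) * t) ^ 2 +
      4 * ((‖ρ (0, 0) (1, 1)‖ + ‖ρ (0, 1) (1, 0)‖) ^ 2 * (s * t))) / p ^ 2 := by
  obtain ⟨hα, hγ⟩ := marginals_pos hρ hm
  rw [conic, semiaxis₁, div_pow, sq_sqrt hm.le, centre, slope, margDet]
  rw [margDet] at hm
  generalize (ρ (0, 0) (0, 0)).re = a at *
  generalize (ρ (0, 1) (0, 1)).re = b at *
  generalize (ρ (1, 0) (1, 0)).re = c at *
  generalize (ρ (1, 1) (1, 1)).re = d at *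
  generalize ‖ρ (0, 0) (1, 1)‖ + ‖ρ (0, 1) (1, 0)‖ = W
  have hs : s = p * (1 + z) / 2 / (a + b) := by rw [← h0]; field_simp
  have ht : t = p * (1 - z) / 2 / (c + d) := by rw [← h1]; field_simp
  rw [hs, ht]
  field_simp
  ring

/-- The ellipse lies in the Bloch ball. After the height is moved to the other side, the upper bound
reads (|u| + |v|)² st ≤ (as + ct)(bs + dt), which follows from |u|² ≤ ad, |v|² ≤ bc and the
arithmetic–geometric mean inequality. -/
theorem conic_mem (hρ : IsXState ρ) (hm : 0 < margDet ρ) {z : ℝ} (hz : z ∈ Icc (-1 : ℝ) 1) :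
    conic ρ z ∈ Icc (0 : ℝ) 1 := by
  obtain ⟨hα, hγ⟩ := marginals_pos hρ hm
  obtain ⟨ha, hb, hc, hd, hsum, hu, hv⟩ := hρ.entries
  refine ⟨by
    have : 0 ≤ 1 - z ^ 2 := by nlinarith [hz.1, hz.2]
    unfold conic; positivity, ?_⟩
  -- s and t play the role of the diagonal entries of an outcome with probability 1 and height z.
  set s := (1 + z) / 2 / ((ρ (0, 0) (0, 0)).re + (ρ (0, 1) (0, 1)).re) with hs
  set t := (1 - z) / 2 / ((ρ (1, 0) (1, 0)).re + (ρ (1, 1) (1, 1)).re) with ht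
  have hs0 : 0 ≤ s := div_nonneg (by linarith [hz.1]) hα.le
  have ht0 : 0 ≤ t := div_nonneg (by linarith [hz.2]) hγ.le
  have h0 : ((ρ (0, 0) (0, 0)).re + (ρ (0, 1) (0, 1)).re) * s = (1 + z) / 2 := by
    rw [hs]; field_simp
  have h1 : ((ρ (1, 0) (1, 0)).re + (ρ (1, 1) (1, 1)).re) * t = (1 - z) / 2 := by
    rw [ht]; field_simp
  clear_value s t
  rw [conic_div hρ hm one_ne_zero (h0.trans (by ring)) (h1.trans (by ring)), one_pow, div_one]
  generalize (ρ (0, 0) (0, 0)).re = a at *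
  generalize (ρ (0, 1) (0, 1)).re = b at *
  generalize (ρ (1, 0) (1, 0)).re = c at *
  generalize (ρ (1, 1) (1, 1)).re = d at *
  have hu' : ‖ρ (0, 0) (1, 1)‖ ≤ √(a * d) := le_sqrt_of_sq_le hu
  have hv' : ‖ρ (0, 1) (1, 0)‖ ≤ √(b * c) := le_sqrt_of_sq_le hv
  have hW : (‖ρ (0, 0) (1, 1)‖ + ‖ρ (0, 1) (1, 0)‖) ^ 2 ≤ (√(a * d) + √(b * c)) ^ 2 := by
    gcongr
  have e1 : √(a * d) ^ 2 = a * d := sq_sqrt (by positivity)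
  have e2 : √(b * c) ^ 2 = b * c := sq_sqrt (by positivity)
  have e3 : √(a * d) * √(b * c) * (s * t) = √(a * b * s ^ 2) * √(c * d * t ^ 2) := by
    rw [← sqrt_mul (by positivity), ← sqrt_mul (by positivity),
      show a * b * s ^ 2 * (c * d * t ^ 2) = a * d * (b * c) * (s * t) ^ 2 by ring,
      sqrt_mul (by positivity) ((s * t) ^ 2), sqrt_sq (by positivity)]
  have e4 : √(a * b * s ^ 2) ^ 2 = a * b * s ^ 2 := sq_sqrt (by positivity)
  have e5 : √(c * d * t ^ 2) ^ 2 = c * d * t ^ 2 := sq_sqrt (by positivity)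
  have h2 := sq_nonneg (√(a * b * s ^ 2) - √(c * d * t ^ 2))
  have h3 := mul_le_mul_of_nonneg_right hW (mul_nonneg hs0 ht0)
  have h6 : (√(a * d) + √(b * c)) ^ 2 * (s * t) =
      (a * d + b * c) * (s * t) + 2 * (√(a * b * s ^ 2) * √(c * d * t ^ 2)) := by
    rw [← e3]
    linear_combination (s * t) * e1 + (s * t) * e2
  have h4 : (a + b) * s + (c + d) * t = 1 := by rw [h0, h1]; ring
  have h5 : ((a + b) * s + (c + d) * t) ^ 2 = 1 := by rw [h4, one_pow]
  linarith

theorem outcomeProb_mul_height (hρ : IsXState ρ) (hm : 0 < margDet ρ) {E : Qubit}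
    (hE : E.PosSemidef) : outcomeProb ρ E * height ρ E =
      ((ρ (0, 0) (0, 0)).re + (ρ (0, 1) (0, 1)).re) * (E 0 0).re -
      ((ρ (1, 0) (1, 0)).re + (ρ (1, 1) (1, 1)).re) * (E 1 1).re := by
  rcases (outcomeProb_nonneg hρ hE).eq_or_lt with h | hp
  · rw [← h, zero_mul]
    obtain ⟨hα, hγ⟩ := marginals_pos hρ hm
    rw [outcomeProb_eq hρ hE] at h
    obtain ⟨-, -, -, h0, h1, -⟩ := PosSemidef.entries hE
    nlinarith [mul_nonneg hα.le h0, mul_nonneg hγ.le h1]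
  · rw [height, mul_div_cancel₀ _ hp.ne']

theorem diag_eq_height (hρ : IsXState ρ) (hm : 0 < margDet ρ) {E : Qubit} (hE : E.PosSemidef) :
    ((ρ (0, 0) (0, 0)).re + (ρ (0, 1) (0, 1)).re) * (E 0 0).re =
      outcomeProb ρ E * (1 + height ρ E) / 2 ∧
    ((ρ (1, 0) (1, 0)).re + (ρ (1, 1) (1, 1)).re) * (E 1 1).re =
      outcomeProb ρ E * (1 - height ρ E) / 2 := by
  have h1 := outcomeProb_mul_height hρ hm hE
  have h2 := outcomeProb_eq hρ hE
  constructor <;> linarith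

theorem height_mem (hρ : IsXState ρ) (hm : 0 < margDet ρ) {E : Qubit} (hE : E.PosSemidef) :
    height ρ E ∈ Icc (-1 : ℝ) 1 := by
  rcases (outcomeProb_nonneg hρ hE).eq_or_lt with h | hp
  -- For probability zero the height is 0 by division by zero.
  · simp [height, ← h]
  obtain ⟨h0, h1⟩ := diag_eq_height hρ hm hE
  obtain ⟨hα, hγ⟩ := marginals_pos hρ hm
  obtain ⟨-, -, -, k0, k1, -⟩ := PosSemidef.entries hE
  have := mul_nonneg hα.le k0
  have := mul_nonneg hγ.le k1
  constructor <;> nlinarith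

theorem conic_height (hρ : IsXState ρ) (hm : 0 < margDet ρ) {E : Qubit} (hE : E.PosSemidef)
    (hp : 0 < outcomeProb ρ E) : conic ρ (height ρ E) = (steeredHeight ρ E ^ 2 +
      4 * ((‖ρ (0, 0) (1, 1)‖ + ‖ρ (0, 1) (1, 0)‖) ^ 2 * ((E 0 0).re * (E 1 1).re))) /
      outcomeProb ρ E ^ 2 := by
  obtain ⟨h0, h1⟩ := diag_eq_height hρ hm hE
  exact conic_div hρ hm hp.ne' h0 h1

/-- Triangle inequality followed by |E₀₁|² ≤ E₀₀E₁₁; rank one and aligned phases give equality. -/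
theorem norm_steeredOffDiag_sq_le {E : Qubit} (hE : E.PosSemidef) : ‖steeredOffDiag ρ E‖ ^ 2 ≤
    (‖ρ (0, 0) (1, 1)‖ + ‖ρ (0, 1) (1, 0)‖) ^ 2 * ((E 0 0).re * (E 1 1).re) := by
  have h1 : ‖steeredOffDiag ρ E‖ ≤ (‖ρ (0, 0) (1, 1)‖ + ‖ρ (0, 1) (1, 0)‖) * ‖E 0 1‖ := by
    refine (norm_add_le _ _).trans_eq ?_
    simp only [norm_mul, RCLike.norm_conj]
    ring
  calc ‖steeredOffDiag ρ E‖ ^ 2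
      ≤ ((‖ρ (0, 0) (1, 1)‖ + ‖ρ (0, 1) (1, 0)‖) * ‖E 0 1‖) ^ 2 := by gcongr
    _ = (‖ρ (0, 0) (1, 1)‖ + ‖ρ (0, 1) (1, 0)‖) ^ 2 * ‖E 0 1‖ ^ 2 := by ring
    _ ≤ _ := by gcongr; exact (PosSemidef.entries hE).2.2.2.2.2

theorem conditionalBlochSq_le (hρ : IsXState ρ) (hm : 0 < margDet ρ) {E : Qubit}
    (hE : E.PosSemidef) (hp : 0 < outcomeProb ρ E) :
    conditionalBlochSq ρ E ≤ conic ρ (height ρ E) := by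
  rw [conic_height hρ hm hE hp, conditionalBlochSq]
  gcongr
  exact norm_steeredOffDiag_sq_le hE

theorem conditionalBlochSq_nonneg (ρ : TwoQubit) (E : Qubit) : 0 ≤ conditionalBlochSq ρ E := by
  unfold conditionalBlochSq; positivity

theorem blochEntropy_conic_le (hρ : IsXState ρ) (hm : 0 < margDet ρ) {E : Qubit}
    (hE : E.PosSemidef) : outcomeProb ρ E * blochEntropy (conic ρ (height ρ E)) ≤
      outcomeProb ρ E * blochEntropy (conditionalBlochSq ρ E) := by
  rcases (outcomeProb_nonneg hρ hE).eq_or_lt with h | hp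
  · simp [← h]
  have h1 := conditionalBlochSq_le hρ hm hE hp
  have h2 := conic_mem hρ hm (height_mem hρ hm hE)
  exact mul_le_mul_of_nonneg_left (strictAntiOn_blochEntropy.antitoneOn
    ⟨conditionalBlochSq_nonneg ρ E, h1.trans h2.2⟩ h2 h1) hp.le

theorem sum_outcomeProb_mul_height (hρ : IsXState ρ) (hm : 0 < margDet ρ) {k : ℕ} (M : POVM k) :
    ∑ i, outcomeProb ρ (M.elem i) * height ρ (M.elem i) = marginalHeight ρ := by
  simp only [fun i => outcomeProb_mul_height hρ hm (M.posSemidef i)]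
  rw [Finset.sum_sub_distrib, ← Finset.mul_sum, ← Finset.mul_sum, M.sum_diag, M.sum_diag,
    marginalHeight]
  ring

/-- The average of an affine function of the height is the same for all POVMs, so an affine minorant
of g bounds every average entropy by one number. -/
theorem sum_outcomeProb_mul_affine (hρ : IsXState ρ) (hm : 0 < margDet ρ) {k : ℕ} (M : POVM k)
    (m s : ℝ) : ∑ i, outcomeProb ρ (M.elem i) * (m + s * height ρ (M.elem i)) =
      m + s * marginalHeight ρ := by
  have h1 := sum_outcomeProb hρ M
  have h2 := sum_outcomeProb_mul_height hρ hm M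
  calc _ = m * ∑ i, outcomeProb ρ (M.elem i) +
        s * ∑ i, outcomeProb ρ (M.elem i) * height ρ (M.elem i) := by
        rw [Finset.mul_sum, Finset.mul_sum, ← Finset.sum_add_distrib]
        exact Finset.sum_congr rfl fun i _ => by ring
    _ = _ := by rw [h1, h2, mul_one]

variable {m s : ℝ}

theorem affine_le_of_outcome (hρ : IsXState ρ) (hm : 0 < margDet ρ)
    (hle : ∀ w ∈ Icc (-1 : ℝ) 1, m + s * w ≤ blochEntropy (conic ρ w)) {E : Qubit}
    (hE : E.PosSemidef) : outcomeProb ρ E * (m + s * height ρ E) ≤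
      outcomeProb ρ E * blochEntropy (conditionalBlochSq ρ E) :=
  (mul_le_mul_of_nonneg_left (hle _ (height_mem hρ hm hE)) (outcomeProb_nonneg hρ hE)).trans
    (blochEntropy_conic_le hρ hm hE)

theorem affine_le_averageEntropy (hρ : IsXState ρ) (hm : 0 < margDet ρ)
    (hle : ∀ w ∈ Icc (-1 : ℝ) 1, m + s * w ≤ blochEntropy (conic ρ w)) {k : ℕ} (M : POVM k) :
    m + s * marginalHeight ρ ≤ averageEntropy ρ M * log 2 := by
  rw [averageEntropy_mul_log_two hρ, ← sum_outcomeProb_mul_affine hρ hm M]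
  exact Finset.sum_le_sum fun i _ => affine_le_of_outcome hρ hm hle (M.posSemidef i)

theorem isOptimal_of_eq (hρ : IsXState ρ) (hm : 0 < margDet ρ)
    (hle : ∀ w ∈ Icc (-1 : ℝ) 1, m + s * w ≤ blochEntropy (conic ρ w)) {k : ℕ} {M : POVM k}
    (h : averageEntropy ρ M * log 2 = m + s * marginalHeight ρ) : IsOptimal ρ M := fun _ N =>
  le_of_mul_le_mul_right (h.trans_le (affine_le_averageEntropy hρ hm hle N)) (log_pos one_lt_two)

/-- In a POVM that attains the bound, every outcome lies on the ellipse at a point of contact. -/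
theorem outcome_of_averageEntropy_le (hρ : IsXState ρ) (hm : 0 < margDet ρ)
    (hle : ∀ w ∈ Icc (-1 : ℝ) 1, m + s * w ≤ blochEntropy (conic ρ w)) {k : ℕ} {M : POVM k}
    (h : averageEntropy ρ M * log 2 ≤ m + s * marginalHeight ρ) (i : Fin k)
    (hp : 0 < outcomeProb ρ (M.elem i)) :
    blochEntropy (conic ρ (height ρ (M.elem i))) = m + s * height ρ (M.elem i) ∧
      ‖steeredOffDiag ρ (M.elem i)‖ ^ 2 = (‖ρ (0, 0) (1, 1)‖ + ‖ρ (0, 1) (1, 0)‖) ^ 2 *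
        ((M.elem i 0 0).re * (M.elem i 1 1).re) := by
  rw [averageEntropy_mul_log_two hρ, ← sum_outcomeProb_mul_affine hρ hm M] at h
  have hsum := (Finset.sum_eq_sum_iff_of_le fun i _ =>
    affine_le_of_outcome hρ hm hle (M.posSemidef i)).1
    (le_antisymm (Finset.sum_le_sum fun i _ => affine_le_of_outcome hρ hm hle (M.posSemidef i)) h)
    i (Finset.mem_univ i)
  have hE := M.posSemidef i
  have h1 := mul_left_cancel₀ hp.ne' hsum
  have h2 := le_of_mul_le_mul_left (blochEntropy_conic_le hρ hm hE) hp
  have hmem := height_mem hρ hm hE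
  have h3 := hle _ hmem
  have h4 : blochEntropy (conic ρ (height ρ (M.elem i))) = m + s * height ρ (M.elem i) := by
    linarith
  refine ⟨h4, ?_⟩
  have h5 := conditionalBlochSq_le hρ hm hE hp
  have h6 := conic_mem hρ hm hmem
  -- Equal entropies force equal Bloch lengths, so the outcome is on the ellipse and not inside it.
  have h7 := strictAntiOn_blochEntropy.injOn ⟨conditionalBlochSq_nonneg ρ _, h5.trans h6.2⟩ h6
    (h1.symm.trans h4.symm)
  rw [conic_height hρ hm hE hp, conditionalBlochSq, div_left_inj' (by positivity)] at h7
  linarith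

end Conic

/-! ### Rank-one POVMs in one vertical plane. -/

section Rays

/-- The rank-one operator with vector `(x, y * conj ω)`. -/
noncomputable def rayElem (ω : ℂ) (x y : ℝ) : Qubit :=
  Matrix.vecMulVec ![(x : ℂ), y * conj ω] (star ![(x : ℂ), y * conj ω])

variable {ω : ℂ} {x y : ℝ}

theorem rayElem_apply (hω : ‖ω‖ = 1) : rayElem ω x y 0 0 = ((x ^ 2 : ℝ) : ℂ) ∧
    rayElem ω x y 1 1 = ((y ^ 2 : ℝ) : ℂ) ∧ rayElem ω x y 0 1 = ((x * y : ℝ) : ℂ) * ω ∧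
    rayElem ω x y 1 0 = ((x * y : ℝ) : ℂ) * conj ω := by
  have h : conj ω * ω = 1 := by
    rw [mul_comm, Complex.mul_conj, Complex.normSq_eq_norm_sq, hω]; norm_num
  refine ⟨?_, ?_, ?_, ?_⟩ <;> simp [rayElem, Matrix.vecMulVec_apply]
  · ring
  · linear_combination (y : ℂ) ^ 2 * h
  · ring
  · ring

theorem rayElem_posSemidef : (rayElem ω x y).PosSemidef :=
  Matrix.posSemidef_vecMulVec_self_star _

theorem rank_rayElem (hω : ‖ω‖ = 1) (h : x ≠ 0 ∨ y ≠ 0) : (rayElem ω x y).rank = 1 := by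
  refine le_antisymm (Matrix.rank_vecMulVec_le _ _) (Nat.one_le_iff_ne_zero.2 fun h0 => ?_)
  have hlin : (rayElem ω x y).mulVecLin = 0 :=
    LinearMap.range_eq_bot.1 (Submodule.finrank_eq_zero.1 h0)
  have hz : rayElem ω x y = 0 := by
    ext i j
    simpa using congrFun (LinearMap.congr_fun hlin (Pi.single j 1)) i
  obtain ⟨h1, h2, -, -⟩ := rayElem_apply (x := x) (y := y) hω
  rw [hz] at h1 h2
  simp only [Matrix.zero_apply] at h1 h2
  norm_cast at h1 h2
  rcases h with h | h
  · exact h (pow_eq_zero_iff two_ne_zero |>.1 h1.symm)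
  · exact h (pow_eq_zero_iff two_ne_zero |>.1 h2.symm)

/-- Proportionality would give x² = c x'², y² = c y'² and xy = c x'y', hence (xy' - x'y)² = 0. -/
theorem rayElem_ne_smul (hω : ‖ω‖ = 1) {x' y' : ℝ} (h : x * y' ≠ x' * y) (c : ℝ) :
    rayElem ω x y ≠ (c : ℂ) • rayElem ω x' y' := fun he => by
  obtain ⟨h1, h2, h3, -⟩ := rayElem_apply (x := x) (y := y) hω
  obtain ⟨h1', h2', h3', -⟩ := rayElem_apply (x := x') (y := y') hω
  have hω0 : ω ≠ 0 := by rintro rfl; simp at hω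
  rw [he, Matrix.smul_apply, smul_eq_mul] at h1 h2 h3
  rw [h1'] at h1
  rw [h2'] at h2
  rw [h3', ← mul_assoc] at h3
  have h3 := mul_right_cancel₀ hω0 h3
  norm_cast at h1 h2 h3
  refine h (sub_eq_zero.1 (pow_eq_zero_iff two_ne_zero |>.1 ?_))
  linear_combination -(y' ^ 2) * h1 - x' ^ 2 * h2 + 2 * x' * y' * h3

/-- The POVM with elements `rayElem ω (x i) (y i)`. -/
noncomputable def rayPOVM {k : ℕ} {ω : ℂ} (hω : ‖ω‖ = 1) (x y : Fin k → ℝ)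
    (hx : ∑ i, x i ^ 2 = 1) (hy : ∑ i, y i ^ 2 = 1) (hxy : ∑ i, x i * y i = 0) : POVM k where
  elem i := rayElem ω (x i) (y i)
  posSemidef _ := rayElem_posSemidef
  sum_eq_one := by
    ext i j
    rw [Matrix.sum_apply]
    fin_cases i <;> fin_cases j <;>
      simp only [Fin.zero_eta, Fin.mk_one, (rayElem_apply hω).1, (rayElem_apply hω).2.1,
        (rayElem_apply hω).2.2.1, (rayElem_apply hω).2.2.2, ← Finset.sum_mul, ← Complex.ofReal_sum,
        hx, hy, hxy] <;> simp

variable {ρ : TwoQubit}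

/-- The off-diagonal entry is a real multiple of the aligning phase ω, so the bound on the
conditional Bloch length is attained. -/
theorem outcome_rayElem (hρ : IsXState ρ) (hm : 0 < margDet ρ) (hω : ‖ω‖ = 1)
    (hphase : ∀ ξ : ℂ, ‖ξ * ω * conj (ρ (0, 1) (1, 0)) + conj (ξ * ω) * ρ (0, 0) (1, 1)‖ ^ 2 =
      ((‖ρ (0, 0) (1, 1)‖ + ‖ρ (0, 1) (1, 0)‖) * ξ.re) ^ 2 +
        ((‖ρ (0, 0) (1, 1)‖ - ‖ρ (0, 1) (1, 0)‖) * ξ.im) ^ 2) {l z : ℝ} (hl : 0 < l)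
    (hx : ((ρ (0, 0) (0, 0)).re + (ρ (0, 1) (0, 1)).re) * x ^ 2 = l * (1 + z) / 2)
    (hy : ((ρ (1, 0) (1, 0)).re + (ρ (1, 1) (1, 1)).re) * y ^ 2 = l * (1 - z) / 2) :
    outcomeProb ρ (rayElem ω x y) * blochEntropy (conditionalBlochSq ρ (rayElem ω x y)) =
      l * blochEntropy (conic ρ z) := by
  obtain ⟨h1, h2, h3, -⟩ := rayElem_apply (x := x) (y := y) hω
  have hE : (rayElem ω x y).PosSemidef := rayElem_posSemidef
  have hp : outcomeProb ρ (rayElem ω x y) = l := by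
    rw [outcomeProb_eq hρ hE, h1, h2, Complex.ofReal_re, Complex.ofReal_re, hx, hy]; ring
  have hz : height ρ (rayElem ω x y) = z := by
    rw [height, hp, h1, h2, Complex.ofReal_re, Complex.ofReal_re, hx, hy]; field_simp; ring
  have hq := conic_height hρ hm hE (hp ▸ hl)
  rw [hz] at hq
  rw [hp, hq, conditionalBlochSq, steeredOffDiag, h3, hphase, h1, h2]
  simp only [Complex.ofReal_re, Complex.ofReal_im]
  congr 4
  ring

/-- A POVM with outcomes of probabilities `l i` at heights `z i` on the ellipse; the signs `ε i`
choose between the two points of the ellipse with the same height. -/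
theorem exists_rayPOVM (hρ : IsXState ρ) (hm : 0 < margDet ρ) {k : ℕ} (l z ε : Fin k → ℝ)
    (hl : ∀ i, 0 < l i) (hz : ∀ i, z i ∈ Icc (-1 : ℝ) 1) (hε : ∀ i, ε i = 1 ∨ ε i = -1)
    (hsum : ∑ i, l i = 1) (hsumz : ∑ i, l i * z i = marginalHeight ρ)
    (hsumx : ∑ i, ε i * (l i * √(1 - z i ^ 2)) = 0) :
    ∃ M : POVM k, (∀ i, (M.elem i).rank = 1) ∧
      averageEntropy ρ M * log 2 = ∑ i, l i * blochEntropy (conic ρ (z i)) ∧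
      ∀ i j, z i ≠ z j ∨ (z i = z j ∧ z i ^ 2 < 1 ∧ ε i ≠ ε j) →
        ∀ c : ℝ, M.elem i ≠ (c : ℂ) • M.elem j := by
  obtain ⟨ω, hω, hphase⟩ := exists_phase (ρ (0, 0) (1, 1)) (ρ (0, 1) (1, 0))
  obtain ⟨hα, hγ⟩ := marginals_pos hρ hm
  have htot := hρ.entries.2.2.2.2.1
  rw [marginalHeight] at hsumz
  set α := (ρ (0, 0) (0, 0)).re + (ρ (0, 1) (0, 1)).re with hαdef
  set γ := (ρ (1, 0) (1, 0)).re + (ρ (1, 1) (1, 1)).re with hγdef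
  -- x and y solve αx² = l(1 + z)/2 and γy² = l(1 - z)/2, the hypotheses of `outcome_rayElem`.
  set x : Fin k → ℝ := fun i => √(l i * (1 + z i) / 2 / α) with hxdef
  set y : Fin k → ℝ := fun i => ε i * √(l i * (1 - z i) / 2 / γ) with hydef
  have hε2 : ∀ i, ε i ^ 2 = 1 := fun i => by rcases hε i with h | h <;> rw [h] <;> norm_num
  have hz1 : ∀ i, 0 ≤ 1 + z i := fun i => by linarith [(hz i).1]
  have hz2 : ∀ i, 0 ≤ 1 - z i := fun i => by linarith [(hz i).2]
  have hx2 : ∀ i, x i ^ 2 = l i * (1 + z i) / 2 / α := fun i =>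
    sq_sqrt (by have := hl i; have := hz1 i; positivity)
  have hy2 : ∀ i, y i ^ 2 = l i * (1 - z i) / 2 / γ := fun i => by
    rw [hydef]
    simp only
    rw [mul_pow, hε2, one_mul]
    exact sq_sqrt (by have := hl i; have := hz2 i; positivity)
  -- The denominator does not depend on i, so `hsumx` is the vanishing of the off-diagonal entry of
  -- the sum.
  have hxy : ∀ i, x i * y i = ε i * (l i * √(1 - z i ^ 2)) / (2 * √(α * γ)) := fun i => by
    have h1 : √(l i * (1 + z i) / 2 / α) * √(l i * (1 - z i) / 2 / γ) =
        l i * √(1 - z i ^ 2) / (2 * √(α * γ)) := by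
      have := hl i
      have := hz1 i
      rw [← sqrt_mul (by positivity), show l i * (1 + z i) / 2 / α * (l i * (1 - z i) / 2 / γ) =
        (l i / 2) ^ 2 * ((1 - z i ^ 2) / (α * γ)) by field_simp; ring,
        sqrt_mul (by positivity), sqrt_sq (by positivity), sqrt_div (by nlinarith [hz2 i])]
      ring
    rw [hxdef, hydef]
    simp only
    rw [mul_left_comm, h1]
    ring
  have hsx : ∑ i, x i ^ 2 = 1 := by
    have : ∑ i, l i * (1 + z i) = 2 * α := by
      simp only [mul_add, mul_one, Finset.sum_add_distrib, hsum, hsumz]; linarith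
    simp only [hx2, ← Finset.sum_div, this]
    field_simp
  have hsy : ∑ i, y i ^ 2 = 1 := by
    have : ∑ i, l i * (1 - z i) = 2 * γ := by
      simp only [mul_sub, mul_one, Finset.sum_sub_distrib, hsum, hsumz]; linarith
    simp only [hy2, ← Finset.sum_div, this]
    field_simp
  have hsxy : ∑ i, x i * y i = 0 := by
    simp only [hxy, ← Finset.sum_div, hsumx, zero_div]
  refine ⟨rayPOVM hω x y hsx hsy hsxy, fun i => rank_rayElem hω ?_, ?_, fun i j hij c =>
    rayElem_ne_smul hω (fun he => ?_) c⟩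
  · by_contra! h0
    have h1 := hx2 i
    have h2 := hy2 i
    rw [h0.1] at h1
    rw [h0.2] at h2
    have hli := hl i
    field_simp at h1 h2
    nlinarith
  · rw [averageEntropy_mul_log_two hρ]
    refine Finset.sum_congr rfl fun i _ => ?_
    exact outcome_rayElem hρ hm hω hphase (hl i) (by rw [hx2, ← hαdef]; field_simp)
      (by rw [hy2, ← hγdef]; field_simp)
  · have hli := hl i
    have hlj := hl j
    -- Different heights give different ratios x² : y²; at equal interior heights, opposite signs
    -- separate the two rays.
    rcases hij with hij | ⟨hij, hlt, hne⟩
    · have hsq : x i ^ 2 * y j ^ 2 = x j ^ 2 * y i ^ 2 := by rw [← mul_pow, he, mul_pow]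
      rw [hx2, hx2, hy2, hy2] at hsq
      field_simp at hsq
      exact hij (by linarith)
    · have hz3 : 0 < 1 + z i := by nlinarith [hz1 i, hz2 i]
      have hz4 : 0 < 1 - z i := by nlinarith [hz1 i, hz2 i]
      have p1 : 0 < x i := sqrt_pos.2 (by positivity)
      have p2 : 0 < x j := sqrt_pos.2 (by rw [← hij]; positivity)
      have p3 : 0 < √(l i * (1 - z i) / 2 / γ) := sqrt_pos.2 (by positivity)
      have p4 : 0 < √(l j * (1 - z j) / 2 / γ) := sqrt_pos.2 (by rw [← hij]; positivity)
      have he' : x i * (ε j * √(l j * (1 - z j) / 2 / γ)) =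
        x j * (ε i * √(l i * (1 - z i) / 2 / γ)) := he
      have q1 := mul_pos p1 p4
      have q2 := mul_pos p2 p3
      rcases hε i with hi | hi <;> rcases hε j with hj | hj
      · exact hne (hi.trans hj.symm)
      · rw [hi, hj] at he'; nlinarith
      · rw [hi, hj] at he'; nlinarith
      · exact hne (hi.trans hj.symm)

end Rays


variable {ρ : TwoQubit}

/-! ### Existence of an optimal POVM with two or three elements. -/

section Existence

variable {m s : ℝ}

/-- If the envelope agrees with g at the marginal height, the two mirror points at that height with
weight 1/2 each suffice. -/
theorem exists_attaining_of_marginalHeight (hρ : IsXState ρ) (hm : 0 < margDet ρ)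
    (hz : marginalHeight ρ ∈ Icc (-1 : ℝ) 1)
    (h : blochEntropy (conic ρ (marginalHeight ρ)) = m + s * marginalHeight ρ) :
    ∃ M : POVM 2, M.IsVonNeumann ∧
      averageEntropy ρ M * log 2 = m + s * marginalHeight ρ := by
  obtain ⟨M, hr, hav, -⟩ := exists_rayPOVM hρ hm ![1 / 2, 1 / 2]
    ![marginalHeight ρ, marginalHeight ρ] ![1, -1] (by simp [Fin.forall_fin_two])
    (by simp [Fin.forall_fin_two, hz.1, hz.2]) (by simp [Fin.forall_fin_two])
    (by norm_num [Fin.sum_univ_two]) (by simp [Fin.sum_univ_two]; ring) (by simp [Fin.sum_univ_two])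
  refine ⟨M, M.isVonNeumann_of_rank hr, hav.trans ?_⟩
  simp [Fin.sum_univ_two, h]
  ring

theorem exists_attaining_of_pair (hρ : IsXState ρ) (hm : 0 < margDet ρ) {z₁ z₂ c : ℝ}
    (hz₁ : z₁ ∈ Icc (-1 : ℝ) 1) (hz₂ : z₂ ∈ Icc (-1 : ℝ) 1) (hne : z₁ ≠ z₂) (hc0 : 0 < c)
    (hc1 : c < 1) (hsum : c * z₁ + (1 - c) * z₂ = marginalHeight ρ)
    (h : c * blochEntropy (conic ρ z₁) + (1 - c) * blochEntropy (conic ρ z₂) =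
      m + s * marginalHeight ρ)
    (hx : c * √(1 - z₁ ^ 2) ≤ (1 - c) * √(1 - z₂ ^ 2)) :
    (∃ M : POVM 2, M.IsVonNeumann ∧
      averageEntropy ρ M * log 2 = m + s * marginalHeight ρ) ∨
      (∃ M : POVM 3, M.IsRankOne ∧ averageEntropy ρ M * log 2 = m + s * marginalHeight ρ) := by
  rcases hx.eq_or_lt with hx | hx
  · left
    obtain ⟨M, hr, hav, -⟩ := exists_rayPOVM hρ hm ![c, 1 - c] ![z₁, z₂] ![1, -1]
      (by simp [Fin.forall_fin_two, hc0, hc1])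
      (by simp [Fin.forall_fin_two, hz₁.1, hz₁.2, hz₂.1, hz₂.2]) (by simp [Fin.forall_fin_two])
      (by simp [Fin.sum_univ_two]) (by simpa [Fin.sum_univ_two] using hsum)
      (by simp [Fin.sum_univ_two, hx])
    refine ⟨M, M.isVonNeumann_of_rank hr, hav.trans ?_⟩
    simpa [Fin.sum_univ_two] using h
  · right
    have hx₁ : 0 ≤ √(1 - z₁ ^ 2) := sqrt_nonneg _
    have hX : 0 < (1 - c) * √(1 - z₂ ^ 2) := lt_of_le_of_lt (by positivity) hx
    have hx₂ : 0 < √(1 - z₂ ^ 2) := pos_of_mul_pos_right hX (by linarith)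
    have hlt : z₂ ^ 2 < 1 := by linarith [sqrt_pos.1 hx₂]
    -- Placing weights (1 - c ∓ r)/2 at the mirror points of height z₂ leaves a net horizontal
    -- component -r√(1 - z₂²), which cancels that of z₁. The strict inequality `hx` keeps both
    -- weights positive and the mirror points distinct.
    set r := c * √(1 - z₁ ^ 2) / √(1 - z₂ ^ 2) with hr
    have hr0 : 0 ≤ r := by positivity
    have hr1 : r < 1 - c := (div_lt_iff₀ hx₂).2 hx
    have hrx : r * √(1 - z₂ ^ 2) = c * √(1 - z₁ ^ 2) := div_mul_cancel₀ _ hx₂.ne'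
    obtain ⟨M, hrk, hav, hprop⟩ := exists_rayPOVM hρ hm ![c, (1 - c - r) / 2, (1 - c + r) / 2]
      ![z₁, z₂, z₂] ![1, 1, -1]
      (by
        simp only [Fin.forall_fin_succ, Matrix.cons_val_zero, Matrix.cons_val_succ]
        exact ⟨hc0, by linarith, by linarith, by simp⟩)
      (by simp [Fin.forall_fin_succ, hz₁.1, hz₁.2, hz₂.1, hz₂.2]) (by simp [Fin.forall_fin_succ])
      (by simp [Fin.sum_univ_three]; ring) (by simp [Fin.sum_univ_three]; linarith)
      (by simp [Fin.sum_univ_three]; linarith)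
    refine ⟨M, ⟨hrk, fun i j hij => hprop i j ?_⟩, hav.trans ?_⟩
    · fin_cases i <;> fin_cases j <;> first
        | exact absurd rfl hij
        | exact Or.inl hne
        | exact Or.inl hne.symm
        | exact Or.inr ⟨rfl, hlt, by norm_num⟩
    · rw [← h]
      simp [Fin.sum_univ_three]
      ring

/-- If the marginal of `A` is pure, all POVMs have the same average entropy. -/
theorem exists_optimal_of_margDet_nonpos (hρ : IsXState ρ) (hm : margDet ρ ≤ 0) :
    ∃ M : POVM 2, M.IsVonNeumann ∧ IsOptimal ρ M := by
  have hω : ‖(1 : ℂ)‖ = 1 := norm_one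
  let M : POVM 2 := rayPOVM hω ![1, 0] ![0, 1] (by simp [Fin.sum_univ_two])
    (by simp [Fin.sum_univ_two]) (by simp [Fin.sum_univ_two])
  suffices h : ∃ K, ∀ E : Qubit, E.PosSemidef → outcomeProb ρ E *
      blochEntropy (conditionalBlochSq ρ E) = outcomeProb ρ E * K by
    obtain ⟨K, hK⟩ := h
    have hav : ∀ {k : ℕ} (N : POVM k), averageEntropy ρ N * log 2 = K := fun N => by
      rw [averageEntropy_mul_log_two hρ]
      simp only [fun i => hK _ (N.posSemidef i)]
      rw [← Finset.sum_mul, sum_outcomeProb hρ, one_mul]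
    refine ⟨M, M.isVonNeumann_of_rank fun i => rank_rayElem hω ?_, fun _ N =>
      le_of_mul_le_mul_right ((hav M).trans (hav N).symm).le (log_pos one_lt_two)⟩
    fin_cases i <;> simp
  obtain ⟨ha, hb, hc, hd, hsum, hu, hv⟩ := hρ.entries
  -- A vanishing row of the marginal forces u = v = 0, and every conditional state is the marginal
  -- of `B`; the witness is its entropy.
  refine ⟨blochEntropy (((ρ (0, 0) (0, 0)).re - (ρ (0, 1) (0, 1)).re +
    ((ρ (1, 0) (1, 0)).re - (ρ (1, 1) (1, 1)).re)) ^ 2), fun E hE => ?_⟩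
  rcases (outcomeProb_nonneg hρ hE).eq_or_lt with h | hp
  · simp [← h]
  have hpe := outcomeProb_eq hρ hE
  rw [margDet] at hm
  have huv : ρ (0, 0) (1, 1) = 0 → ρ (0, 1) (1, 0) = 0 → steeredOffDiag ρ E = 0 := fun h1 h2 => by
    simp [steeredOffDiag, h1, h2]
  have hzero : ∀ {w : ℂ} {t : ℝ}, ‖w‖ ^ 2 ≤ t → t = 0 → w = 0 := fun h h0 => by
    rw [h0] at h
    exact norm_eq_zero.1 (pow_eq_zero_iff two_ne_zero |>.1 (le_antisymm h (sq_nonneg _)))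
  congr 2
  have hcase := mul_eq_zero.1 (le_antisymm hm (by positivity))
  rcases hcase with h0 | h0
  · have ha0 : (ρ (0, 0) (0, 0)).re = 0 := by linarith
    have hb0 : (ρ (0, 1) (0, 1)).re = 0 := by linarith
    have := huv (hzero hu (by rw [ha0, zero_mul])) (hzero hv (by rw [hb0, zero_mul]))
    rw [conditionalBlochSq, this, steeredHeight, div_eq_iff (by positivity), hpe, ha0, hb0]
    rw [ha0, hb0] at hsum
    have hd' : (ρ (1, 1) (1, 1)).re = 1 - (ρ (1, 0) (1, 0)).re := by linarith
    rw [hd', norm_zero]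
    ring
  · have hc0 : (ρ (1, 0) (1, 0)).re = 0 := by linarith
    have hd0 : (ρ (1, 1) (1, 1)).re = 0 := by linarith
    have := huv (hzero hu (by rw [hd0, mul_zero])) (hzero hv (by rw [hc0, mul_zero]))
    rw [conditionalBlochSq, this, steeredHeight, div_eq_iff (by positivity), hpe, hc0, hd0]
    rw [hc0, hd0] at hsum
    have hb' : (ρ (0, 1) (0, 1)).re = 1 - (ρ (0, 0) (0, 0)).re := by linarith
    rw [hb', norm_zero]
    ring

theorem marginalHeight_mem (hρ : IsXState ρ) (hm : 0 < margDet ρ) :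
    marginalHeight ρ ∈ Ioo (-1 : ℝ) 1 := by
  obtain ⟨hα, hγ⟩ := marginals_pos hρ hm
  have := hρ.entries.2.2.2.2.1
  rw [marginalHeight]
  constructor <;> linarith

/-- The entropy on the ellipse has an affine lower bound whose value at the marginal of `A` is the
average entropy of a von Neumann measurement or of a rank-one POVM with three elements. -/
theorem exists_affine_le_and_attaining (hρ : IsXState ρ) (hm : 0 < margDet ρ) : ∃ m s : ℝ,
    (∀ w ∈ Icc (-1 : ℝ) 1, m + s * w ≤ blochEntropy (conic ρ w)) ∧
    ((∃ M : POVM 2, M.IsVonNeumann ∧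
      averageEntropy ρ M * log 2 = m + s * marginalHeight ρ) ∨
      (∃ M : POVM 3, M.IsRankOne ∧ averageEntropy ρ M * log 2 = m + s * marginalHeight ρ)) := by
  have hζ := marginalHeight_mem hρ hm
  obtain ⟨m, s, z₁, z₂, c, hz₁, hz₂, hc, hsum, hval, hle⟩ :=
    exists_affine_le_and_eq continuous_blochEntropy_conic hζ
  refine ⟨m, s, hle, ?_⟩
  have single : ∀ z, z = marginalHeight ρ → blochEntropy (conic ρ z) = m + s * marginalHeight ρ →
      ∃ M : POVM 2, M.IsVonNeumann ∧
        averageEntropy ρ M * log 2 = m + s * marginalHeight ρ := by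
    rintro z rfl h
    exact exists_attaining_of_marginalHeight hρ hm (Ioo_subset_Icc_self hζ) h
  rcases hc.1.eq_or_lt with rfl | hc0
  · exact Or.inl (single z₂ (by linarith) (by linarith))
  rcases hc.2.eq_or_lt with rfl | hc1
  · exact Or.inl (single z₁ (by linarith) (by linarith))
  by_cases hne : z₁ = z₂
  · subst hne
    exact Or.inl (single z₁ (by linarith) (by linarith))
  rcases le_total (c * √(1 - z₁ ^ 2)) ((1 - c) * √(1 - z₂ ^ 2)) with hx | hx
  · exact exists_attaining_of_pair hρ hm hz₁ hz₂ hne hc0 hc1 hsum hval hx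
  · exact exists_attaining_of_pair hρ hm hz₂ hz₁ (Ne.symm hne) (sub_pos.2 hc1) (by linarith)
      (by linarith) (by linarith) (by linarith)

/-- Some optimal POVM is a von Neumann measurement or has three elements of rank one. -/
theorem exists_optimal (hρ : IsXState ρ) :
    (∃ M : POVM 2, M.IsVonNeumann ∧ IsOptimal ρ M) ∨
      (∃ M : POVM 3, M.IsRankOne ∧ IsOptimal ρ M) := by
  rcases le_or_gt (margDet ρ) 0 with hm | hm
  · exact Or.inl (exists_optimal_of_margDet_nonpos hρ hm)
  obtain ⟨m, s, hle, h⟩ := exists_affine_le_and_attaining hρ hm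
  exact h.imp (fun ⟨M, hM, h⟩ => ⟨M, hM, isOptimal_of_eq hρ hm hle h⟩)
    fun ⟨M, hM, h⟩ => ⟨M, hM, isOptimal_of_eq hρ hm hle h⟩

end Existence

/-! ### Counting the elements of an optimal POVM. -/

section Uniqueness

/-- The marginal of `A` has full rank, so a positive element of probability zero vanishes. -/
theorem outcomeProb_pos (hρ : IsXState ρ) (hm : 0 < margDet ρ) {E : Qubit} (hE : E.PosSemidef)
    (hr : E.rank = 1) : 0 < outcomeProb ρ E := by
  refine (outcomeProb_nonneg hρ hE).lt_of_ne fun h => ?_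
  obtain ⟨hα, hγ⟩ := marginals_pos hρ hm
  rw [outcomeProb_eq hρ hE] at h
  obtain ⟨e0, e1, e10, h0, h1, h01⟩ := PosSemidef.entries hE
  have k0 := mul_nonneg hα.le h0
  have k1 := mul_nonneg hγ.le h1
  have z0 : (E 0 0).re = 0 := (mul_eq_zero.1 (by linarith)).resolve_left hα.ne'
  have z1 : (E 1 1).re = 0 := (mul_eq_zero.1 (by linarith)).resolve_left hγ.ne'
  rw [z0, zero_mul] at h01
  have z01 : E 0 1 = 0 :=
    norm_eq_zero.1 (pow_eq_zero_iff two_ne_zero |>.1 (le_antisymm h01 (sq_nonneg _)))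
  have : E = 0 := by
    ext i j
    fin_cases i <;> fin_cases j
    · simpa [z0] using e0
    · simpa using z01
    · simpa [z01] using e10
    · simpa [z1] using e1
  rw [this, Matrix.rank_zero] at hr
  exact zero_ne_one hr

/-- If the elements of a rank-one POVM attain the horizontal semiaxis and `u v ≠ 0`, then they
lie in one vertical plane. -/
theorem inVerticalPlane_of_norm_steeredOffDiag {k : ℕ} {M : POVM k}
    (hu : ρ (0, 0) (1, 1) ≠ 0) (hv : ρ (0, 1) (1, 0) ≠ 0) (hr : ∀ i, (M.elem i).rank = 1)
    (h : ∀ i, ‖steeredOffDiag ρ (M.elem i)‖ ^ 2 = (‖ρ (0, 0) (1, 1)‖ + ‖ρ (0, 1) (1, 0)‖) ^ 2 *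
        ((M.elem i 0 0).re * (M.elem i 1 1).re)) : M.InVerticalPlane := by
  obtain ⟨ω, hω, hphase⟩ := exists_phase (ρ (0, 0) (1, 1)) (ρ (0, 1) (1, 0))
  have hω0 : ω ≠ 0 := by rintro rfl; simp at hω
  refine ⟨ω, hω, fun i => ?_⟩
  set ξ := M.elem i 0 1 / ω with hξ
  have hE : M.elem i 0 1 = ξ * ω := (div_mul_cancel₀ _ hω0).symm
  have h1 := h i
  have h2 := PosSemidef.norm_sq_eq_of_rank_eq_one (M.posSemidef i) (hr i)
  rw [hE, norm_mul, hω, mul_one, Complex.sq_norm, Complex.normSq_apply] at h2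
  rw [← h2, steeredOffDiag, hE, hphase] at h1
  -- The two sides of `h1` differ by ((|u| + |v|)² - (|u| - |v|)²) im² = 4|u||v| im².
  have h3 : ‖ρ (0, 0) (1, 1)‖ * ‖ρ (0, 1) (1, 0)‖ * ξ.im ^ 2 = 0 := by linarith
  have h4 : ξ.im = 0 := by
    refine pow_eq_zero_iff two_ne_zero |>.1 ((mul_eq_zero.1 h3).resolve_left ?_)
    exact mul_ne_zero (norm_ne_zero_iff.2 hu) (norm_ne_zero_iff.2 hv)
  refine ⟨ξ.re, ?_⟩
  rw [hE]
  congr 1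
  exact Complex.ext rfl (by simp [h4])

/-- Within one vertical plane, the height and the signed horizontal coordinate per unit probability
determine an element up to scale. -/
theorem eq_smul_of_height_eq (hρ : IsXState ρ) (hm : 0 < margDet ρ) {E F : Qubit}
    (hE : E.PosSemidef) (hF : F.PosSemidef) (hp : 0 < outcomeProb ρ E)
    (hq : 0 < outcomeProb ρ F) {ω : ℂ} {s t : ℝ} (hs : E 0 1 = s * ω) (ht : F 0 1 = t * ω)
    (hz : height ρ E = height ρ F) (hst : s / outcomeProb ρ E = t / outcomeProb ρ F) :
    E = ((outcomeProb ρ E / outcomeProb ρ F : ℝ) : ℂ) • F := by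
  obtain ⟨hα, hγ⟩ := marginals_pos hρ hm
  obtain ⟨a0, a1⟩ := diag_eq_height hρ hm hE
  obtain ⟨b0, b1⟩ := diag_eq_height hρ hm hF
  obtain ⟨e0, e1, e10, -⟩ := PosSemidef.entries hE
  obtain ⟨f0, f1, f10, -⟩ := PosSemidef.entries hF
  rw [hz] at a0 a1
  have c0 : (E 0 0).re = outcomeProb ρ E / outcomeProb ρ F * (F 0 0).re := by
    refine mul_left_cancel₀ hα.ne' ?_
    rw [mul_left_comm, b0, a0]
    field_simp
  have c1 : (E 1 1).re = outcomeProb ρ E / outcomeProb ρ F * (F 1 1).re := by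
    refine mul_left_cancel₀ hγ.ne' ?_
    rw [mul_left_comm, b1, a1]
    field_simp
  have cs : s = outcomeProb ρ E / outcomeProb ρ F * t := by
    rw [div_eq_div_iff hp.ne' hq.ne'] at hst
    field_simp
    linarith
  have c01 : E 0 1 = ((outcomeProb ρ E / outcomeProb ρ F : ℝ) : ℂ) * F 0 1 := by
    rw [hs, ht, cs]; push_cast; ring
  ext i j
  rw [Matrix.smul_apply, smul_eq_mul]
  fin_cases i <;> fin_cases j <;> simp only [Fin.zero_eta, Fin.mk_one]
  · rw [e0, f0, c0, Complex.ofReal_mul]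
  · exact c01
  · rw [e10, f10, c01, map_mul, Complex.conj_ofReal]
  · rw [e1, f1, c1, Complex.ofReal_mul]

/-- An optimal admissible rank-one POVM is a von Neumann measurement or has three elements. -/
theorem isVonNeumann_or_eq_three (hρ : IsXState ρ) (hconst : ¬ HasConstantEntropyEllipse ρ)
    {k : ℕ} {M : POVM k} (hM : M.IsRankOne) (hadm : IsAdmissible ρ M) (hopt : IsOptimal ρ M) :
    M.IsVonNeumann ∨ k = 3 := by
  have hm : 0 < margDet ρ := by
    obtain ⟨ha, hb, hc, hd, -, -, -⟩ := hρ.entries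
    have h0 : 0 ≤ margDet ρ := by unfold margDet; positivity
    -- For `margDet ρ = 0` both semiaxes are 0 by division by zero, which counts as a point ellipse.
    refine h0.lt_of_ne fun h => hconst (Or.inl ?_)
    simp [semiaxis₁, semiaxis₃, ← h]
  obtain ⟨m, s, hle, hatt⟩ := exists_affine_le_and_attaining hρ hm
  have hbound : averageEntropy ρ M * log 2 ≤ m + s * marginalHeight ρ := by
    have hlog := (log_pos one_lt_two).le
    rcases hatt with ⟨N, -, hN⟩ | ⟨N, -, hN⟩
    · exact hN ▸ mul_le_mul_of_nonneg_right (hopt _ N) hlog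
    · exact hN ▸ mul_le_mul_of_nonneg_right (hopt _ N) hlog
  have hp := fun i => outcomeProb_pos hρ hm (M.posSemidef i) (hM.1 i)
  have hout := fun i => outcome_of_averageEntropy_le hρ hm hle hbound i (hp i)
  have hplane : M.InVerticalPlane := by
    rcases hadm with ⟨hu, hv⟩ | h
    · exact inVerticalPlane_of_norm_steeredOffDiag hu hv hM.1 fun i => (hout i).2
    · exact h
  obtain ⟨ω, hω, ht⟩ := hplane
  choose t ht using ht
  obtain ⟨z, e, he, htouch⟩ : TouchesAtMost (fun z => blochEntropy (conic ρ z)) m s := by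
    have hq := fun z hz => conic_mem hρ hm (z := z) hz
    simp only [conic_eq] at hq hle ⊢
    exact touchesAtMost_blochEntropy (conic_ne_constant hm hconst) hq hle
  have htouch' := fun i => htouch _ (height_mem hρ hm (M.posSemidef i)) (hout i).1
  set X : Fin k → ℝ := fun i => t i / outcomeProb ρ (M.elem i) with hX
  obtain ⟨hα, hγ⟩ := marginals_pos hρ hm
  -- Rank one means zero determinant, so the height fixes the horizontal coordinate up to sign, and
  -- fixes it as 0 at an endpoint.
  have hXsq : ∀ i, X i ^ 2 = (1 - height ρ (M.elem i) ^ 2) / (4 * margDet ρ) := fun i => by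
    have h1 := PosSemidef.norm_sq_eq_of_rank_eq_one (M.posSemidef i) (hM.1 i)
    obtain ⟨d0, d1⟩ := diag_eq_height hρ hm (M.posSemidef i)
    rw [ht, norm_mul, hω, mul_one, Complex.norm_real, norm_eq_abs, sq_abs] at h1
    have hpi := hp i
    have h2 : margDet ρ * t i ^ 2 = (outcomeProb ρ (M.elem i) * (1 + height ρ (M.elem i)) / 2) *
        (outcomeProb ρ (M.elem i) * (1 - height ρ (M.elem i)) / 2) := by
      rw [h1, ← d0, ← d1, margDet]; ring
    rw [hX]
    simp only
    rw [div_pow, div_eq_div_iff (by positivity) (by positivity)]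
    linear_combination 4 * h2
  have hmaps : ∀ i ∈ Finset.univ, (height ρ (M.elem i), X i) ∈
      ({(e, 0), (z, √((1 - z ^ 2) / (4 * margDet ρ))),
        (z, -√((1 - z ^ 2) / (4 * margDet ρ)))} : Finset (ℝ × ℝ)) := fun i _ => by
    have h1 := hXsq i
    simp only [Finset.mem_insert, Finset.mem_singleton, Prod.mk.injEq]
    rcases htouch' i with h | h
    · rw [h] at h1 ⊢
      have h2 : √((1 - z ^ 2) / (4 * margDet ρ)) = |X i| := by rw [← h1, sqrt_sq_eq_abs]
      rw [h2]
      rcases abs_cases (X i) with ⟨h', -⟩ | ⟨h', -⟩ <;> rw [h'] <;> simp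
    · rw [h] at h1 ⊢
      have h2 : (1 : ℝ) - e ^ 2 = 0 := by rcases he with rfl | rfl <;> norm_num
      rw [h2, zero_div] at h1
      exact Or.inl ⟨rfl, pow_eq_zero_iff two_ne_zero |>.1 h1⟩
  -- Elements sharing both coordinates would be proportional, so the elements inject into the three
  -- points above.
  have hinj : InjOn (fun i => (height ρ (M.elem i), X i)) (Finset.univ : Finset (Fin k)) := by
    intro i _ j _ hij
    by_contra hne
    obtain ⟨h1, h2⟩ := Prod.mk.inj hij
    exact hM.2 i j hne _ (eq_smul_of_height_eq hρ hm (M.posSemidef i) (M.posSemidef j) (hp i) (hp j)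
      (ht i) (ht j) h1 h2)
  have hcard := (Finset.card_le_card_of_injOn _ hmaps hinj).trans Finset.card_le_three
  rw [Finset.card_univ, Fintype.card_fin] at hcard
  obtain ⟨hk0, hk1⟩ := M.ne_zero hM.1
  rcases (by omega : k = 2 ∨ k = 3) with rfl | h
  · exact Or.inl (M.isVonNeumann_of_rank hM.1)
  · exact Or.inr h

end Uniqueness

end XStateDiscord

theorem mainTheorem1 (ρ : XStateDiscord.TwoQubit) (hρ : XStateDiscord.IsXState ρ) :
    (¬ XStateDiscord.HasConstantEntropyEllipse ρ →
      (∀ M : XStateDiscord.POVM 4, M.IsRankOne → XStateDiscord.IsAdmissible ρ M →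
        ¬ XStateDiscord.IsOptimal ρ M) ∧
      (∀ (k : ℕ) (M : XStateDiscord.POVM k), M.IsRankOne → XStateDiscord.IsAdmissible ρ M →
        XStateDiscord.IsOptimal ρ M →
        M.IsVonNeumann ∨ k = 3)) ∧
    ((∃ M : XStateDiscord.POVM 2, M.IsVonNeumann ∧ XStateDiscord.IsOptimal ρ M) ∨
      (∃ M : XStateDiscord.POVM 3, M.IsRankOne ∧ XStateDiscord.IsOptimal ρ M)) := by
  refine ⟨fun hconst => ?_, XStateDiscord.exists_optimal hρ⟩
  have key : ∀ (k : ℕ) (M : XStateDiscord.POVM k), M.IsRankOne → XStateDiscord.IsAdmissible ρ M →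
      XStateDiscord.IsOptimal ρ M → M.IsVonNeumann ∨ k = 3 := fun k M hM hadm hopt =>
    XStateDiscord.isVonNeumann_or_eq_three hρ hconst hM hadm hopt
  refine ⟨fun M hM hadm hopt => ?_, key⟩
  rcases key 4 M hM hadm hopt with h | h
  · exact absurd h.1 (by decide)
  · exact absurd h (by decide)
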